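/- Let $p$ be an odd prime, $m\ge 1$ and $q=p^m$. Fix an $\mathbb F_p$-linear isomorphism $\mathbb F_q\cong\mathbb F_p^m$, let $\alpha_1,\dots,\alpha_{q-1}$ be the nonzero elements of $\mathbb F_q$, and let $d(p,m,2)$ be the minimum distance (the smallest Hamming weight of a nonzero codeword) of the linear code over $\mathbb F_p$ generated by the rows of the matrix $$\begin{pmatrix}\alpha_1&\alpha_2&\cdots&\alpha_{q-1}\\ \alpha_1^2&\alpha_2^2&\cdots&\alpha_{q-1}^2\end{pmatrix}\in\mathbb F_p^{2m\times(q-1)},$$ where each $\alpha_j^i$ is viewed as a column vector in $\mathbb F_p^m$. For $f\in\mathbb F_q[x]$ let $E_f=\mathbb F_q(x,y)$, with $x$ transcendental over $\mathbb F_q$ and $y^p-y=f(x)$, be the function field of the Artin–Schreier curve defined by $f$, and let $N(E_f)$ be the number of its rational places, that is, places of degree one. Then for every $f\in\mathbb F_q[x]$ with $\deg f=2$, the number $N(E_f)$ is finite and $$N(E_f)\le 1+p\,(q-d(p,m,2))=\begin{cases}q+1+p^{\frac{m+1}2}&\text{if }m\text{ is odd},\\ q+1+(p-1)p^{\frac m2}&\text{if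 }m\text{ is even}.\end{cases}$$ For all such $p$ and $m$ the bound is attained: there is $f\in\mathbb F_q[x]$ with $\deg f=2$ and $N(E_f)=1+p(q-d(p,m,2))$. Moreover, if $m$ is odd, the bound is at most the Serre bound $q+1+\frac{p-1}2\lfloor 2\sqrt q\rfloor$ for these curves, and it is strictly smaller if and only if $q\ne 3$. -/

import Mathlib

universe u v

open scoped Polynomial

/-- A place of the function field `E` over the constant field `F`, given by its valuation ring:
a valuation ring `O` of `E` with `F ⊆ O ≠ E`. -/
structure Place (F E : Type*) [Field F] [Field E] [Algebra F E] where
  ring : ValuationSubring E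
  algebraMap_mem : ∀ a : F, algebraMap F E a ∈ ring
  ne_top : ring ≠ ⊤

namespace Place

variable {F E : Type*} [Field F] [Field E] [Algebra F E]

/-- The valuation ring of a place is an algebra over the constant field. -/
noncomputable instance (P : Place F E) : Algebra F P.ring :=
  ((algebraMap F E).codRestrict P.ring.toSubring P.algebraMap_mem).toAlgebra

/-- The degree of a place: the degree over `F` of its residue field. -/
noncomputable def degree (P : Place F E) : ℕ :=
  Module.finrank F (IsLocalRing.ResidueField P.ring)

end Place

/-- The set of rational places (places of degree one) of `E` over `F`. -/
def rationalPlaces (F E : Type*) [Field F] [Field E] [Algebra F E] : Set (Place F E) :=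
  {P | P.degree = 1}

/-- `E = F(x, y)` is the function field of the Artin-Schreier curve `y ^ p - y = f(x)`,
with `x` transcendental over `F`. -/
structure IsArtinSchreierFunctionField {F E : Type*} [Field F] [Field E] [Algebra F E]
    (p : ℕ) (f : F[X]) (x y : E) : Prop where
  transcendental : Transcendental F x
  equation : y ^ p - y = Polynomial.aeval x f
  generates : IntermediateField.adjoin F {x, y} = ⊤

/-- The minimum distance of a linear code: the smallest Hamming weight of a nonzero codeword. -/
noncomputable def minDistance {k ι : Type*} [Field k] [DecidableEq k] [Fintype ι]
    (C : Submodule k (ι → k)) : ℕ :=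
  sInf {w | ∃ c ∈ C, c ≠ 0 ∧ hammingNorm c = w}

/-- The matrix with the `r` block rows `(α ^ i)`, `i = 1, …, r`, and columns indexed by the nonzero
elements `α` of `F`, where `α ^ i` is written as a column vector of length `m` over `𝔽_p` through
the isomorphism `φ`. -/
def powerMatrix {p m : ℕ} [Fact p.Prime] {F : Type*} [Field F] [Algebra (ZMod p) F]
    (φ : F ≃ₗ[ZMod p] (Fin m → ZMod p)) (r : ℕ) : Matrix (Fin r × Fin m) Fˣ (ZMod p) :=
  fun ij α => φ ((α : F) ^ ((ij.1 : ℕ) + 1)) ij.2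

/-- The linear code over `𝔽_p` of length `q - 1` generated by the rows of `powerMatrix φ r`. -/
def powerCode {p m : ℕ} [Fact p.Prime] {F : Type*} [Field F] [Algebra (ZMod p) F]
    (φ : F ≃ₗ[ZMod p] (Fin m → ZMod p)) (r : ℕ) : Submodule (ZMod p) (Fˣ → ZMod p) :=
  Submodule.span (ZMod p) (Set.range (powerMatrix φ r))

/-- The bound `1 + p (q - d)`, where `q = p ^ m` and `d` is the minimum distance of
`powerCode φ r`. -/
noncomputable def codeBound {p m : ℕ} [Fact p.Prime] {F : Type*} [Field F] [Fintype F]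
    [DecidableEq F] [Algebra (ZMod p) F] (φ : F ≃ₗ[ZMod p] (Fin m → ZMod p)) (r : ℕ) : ℤ :=
  1 + (p : ℤ) * ((p : ℤ) ^ m - (minDistance (powerCode φ r) : ℤ))

/-- The Serre bound `q + 1 + g ⌊2√q⌋` for a curve of genus `g = (r - 1)(p - 1) / 2`, the genus of
`y ^ p - y = f(x)` with `deg f = r` prime to `p`. -/
noncomputable def serreBound (p q r : ℕ) : ℝ :=
  (q : ℝ) + 1 + ((r : ℝ) - 1) * ((p : ℝ) - 1) / 2 * (⌊2 * Real.sqrt (q : ℝ)⌋ : ℝ)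

/-!
Write `S` for the number of `x` with `Tr (f x) = 0`. By additive Hilbert 90, `b ^ p - b = c` has `p`
solutions if `Tr c = 0` and none otherwise, so the affine curve `y ^ p - y = f(x)` has `p S` points.
At such a point `x - a` is a uniformizer, since the partial derivative in `y` is `-1`; hence exactly
one place lies above it, and this place is rational. Where `x` has a pole, the valuations of `x` and
`y` are in the ratio `p : deg f`, so every function is equivalent to some `c x ^ i y ^ j`; this
forces a single rational place there. Therefore `N(E_f) = 1 + p S`.

By duality for the trace form the codewords are the words `Tr (f x)` with `deg f ≤ 2`, `f(0) = 0`.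
If `S > 0`, the condition `f(0) = 0` can be met by a translation in `x`, so `q - d` is the largest
`S` less than `q`. For `deg f = 2`, completing the square turns `p S - q` into a product of
quadratic characters and Gauss sums; only the squares of the Gauss sums are needed, because the
quadratic character takes both signs and so absorbs the sign of the root.
-/

/-! ### Gauss sums -/

section GaussSums

variable {F : Type*} [Field F] [Fintype F] [DecidableEq F] {R : Type*} [CommRing R]

/-- The quadratic character of a finite field `F`, with values in the ring `R` instead of `ℤ`. -/
noncomputable def castQuadraticChar (F : Type*) [Field F] [Fintype F] [DecidableEq F]
    (R : Type*) [CommRing R] : MulChar F R :=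
  (quadraticChar F).ringHomComp (Int.castRingHom R)

theorem castQuadraticChar_apply (a : F) : castQuadraticChar F R a = (quadraticChar F a : R) := rfl

theorem castQuadraticChar_ne_one [CharZero R] (hF : ringChar F ≠ 2) :
    castQuadraticChar F R ≠ 1 :=
  (MulChar.ringHomComp_ne_one_iff (RingHom.injective_int _)).2 (quadraticChar_ne_one hF)

theorem isQuadratic_castQuadraticChar : (castQuadraticChar F R).IsQuadratic :=
  (quadraticChar_isQuadratic F).comp _

theorem gaussSum_castQuadraticChar_mulShift (ψ : AddChar F R) {b : F} (hb : b ≠ 0) :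
    gaussSum (castQuadraticChar F R) (ψ.mulShift b) =
      quadraticChar F b * gaussSum (castQuadraticChar F R) ψ := by
  have h := gaussSum_mulShift_eq (castQuadraticChar F R) ψ (Units.mk0 b hb)
  rwa [isQuadratic_castQuadraticChar.inv] at h

theorem card_filter_sq_eq (hF : ringChar F ≠ 2) (y : F) :
    (Finset.card {x : F | x ^ 2 = y} : ℤ) = quadraticChar F y + 1 := by
  rw [← quadraticChar_card_sqrts hF y]
  congr 2
  ext x
  simp

theorem exists_quadraticChar_eq_units (hF : ringChar F ≠ 2) (e : ℤˣ) :
    ∃ b : F, quadraticChar F b = e := by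
  rcases Int.units_eq_one_or e with rfl | rfl
  · exact ⟨1, map_one _⟩
  · exact quadraticChar_exists_neg_one hF

theorem sum_addChar_mul_sq [IsDomain R] (hF : ringChar F ≠ 2) {ψ : AddChar F R}
    (hψ : ψ.IsPrimitive) {b : F} (hb : b ≠ 0) :
    ∑ x, ψ (b * x ^ 2) = quadraticChar F b * gaussSum (castQuadraticChar F R) ψ := by
  have sum_fibres : ∑ x, ψ (b * x ^ 2) = ∑ y, ((quadraticChar F y : R) + 1) * ψ (b * y) := by
    rw [← Finset.sum_fiberwise (s := Finset.univ) (g := fun x : F => x ^ 2)]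
    refine Finset.sum_congr rfl fun y _ => ?_
    rw [Finset.sum_congr rfl (g := fun _ => ψ (b * y))
      (fun x hx => by rw [(Finset.mem_filter.1 hx).2]), Finset.sum_const, nsmul_eq_mul]
    exact_mod_cast congrArg (fun n : ℤ => (n : R) * ψ (b * y)) (card_filter_sq_eq hF y)
  have sum_mulShift : ∑ y, ψ (b * y) = 0 :=
    AddChar.sum_eq_zero_of_ne_one (ψ := ψ.mulShift b) (hψ hb)
  simp only [sum_fibres, add_mul, one_mul, Finset.sum_add_distrib, sum_mulShift, add_zero]
  exact gaussSum_castQuadraticChar_mulShift ψ hb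

end GaussSums

section TraceCharacter

variable {p m : ℕ} [Fact p.Prime] {F : Type*} [Field F] [Algebra (ZMod p) F]

/-- The additive character `a ↦ exp (2 π i Tr(a) / p)` of a finite field of characteristic `p`. -/
noncomputable def traceChar (p : ℕ) [Fact p.Prime] (F : Type*) [Field F] [Algebra (ZMod p) F] :
    AddChar F ℂ :=
  (ZMod.stdAddChar (N := p)).compAddMonoidHom (Algebra.trace (ZMod p) F).toAddMonoidHom

theorem traceChar_apply (a : F) :
    traceChar p F a = ZMod.stdAddChar (N := p) (Algebra.trace (ZMod p) F a) := rfl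

theorem traceChar_algebraMap_mul (l : ZMod p) (a : F) :
    traceChar p F (algebraMap (ZMod p) F l * a) =
      ZMod.stdAddChar (N := p) (l * Algebra.trace (ZMod p) F a) := by
  rw [traceChar_apply, ← Algebra.smul_def, map_smul, smul_eq_mul]

theorem isPrimitive_traceChar [Finite F] : (traceChar p F).IsPrimitive := by
  obtain ⟨a, ha⟩ := Algebra.trace_surjective (ZMod p) F 1
  refine AddChar.IsPrimitive.of_ne_one fun h => one_ne_zero (α := ZMod p) ?_
  rw [← ha, ← (ZMod.isPrimitive_stdAddChar p).zmod_char_eq_one_iff, ← traceChar_apply, h,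
    AddChar.one_apply]

theorem ringChar_ne_two_of_algebra_zmod (hp : p ≠ 2) : ringChar F ≠ 2 := by
  have : CharP F p := charP_of_injective_algebraMap' (ZMod p) p
  rwa [ringChar.eq F p]

theorem zmod_pow_pow_half (hp : p ≠ 2) (l : ZMod p) (m : ℕ) :
    l ^ (p ^ m / 2) = (l ^ (p / 2)) ^ m := by
  have hodd : Odd p := (Fact.out : p.Prime).odd_of_ne_two hp
  induction m with
  | zero => simp
  | succ n ih =>
    have half_pow_succ : p ^ (n + 1) / 2 = p * (p ^ n / 2) + p / 2 := by
      obtain ⟨k, hk⟩ : Odd (p ^ n) := hodd.pow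
      obtain ⟨j, hj⟩ := hodd
      have : p ^ (n + 1) = 2 * (p * k) + p := by rw [pow_succ, hk]; ring
      rw [show p ^ n / 2 = k by omega]
      omega
    rw [half_pow_succ, pow_add, pow_mul, ZMod.pow_card, ih, pow_succ]

theorem quadraticChar_algebraMap [Fintype F] [DecidableEq F] (hp : p ≠ 2)
    (hq : Fintype.card F = p ^ m) {l : ZMod p} (hl : l ≠ 0) :
    quadraticChar F (algebraMap (ZMod p) F l) = quadraticChar (ZMod p) l ^ m := by
  have hF : ringChar F ≠ 2 := ringChar_ne_two_of_algebra_zmod hp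
  have euler_F := quadraticChar_eq_pow_of_char_ne_two' hF (algebraMap (ZMod p) F l)
  have euler_p := quadraticChar_eq_pow_of_char_ne_two' (F := ZMod p)
    (by rwa [ZMod.ringChar_zmod_n]) l
  rw [ZMod.card p] at euler_p
  rw [hq, ← map_pow, zmod_pow_pow_half hp, ← euler_p] at euler_F
  have cast_eq : ((quadraticChar F (algebraMap (ZMod p) F l) : ℤ) : F) =
      ((quadraticChar (ZMod p) l ^ m : ℤ) : F) := by
    rw [euler_F]; push_cast; simp
  have sign_F := quadraticChar_dichotomy (by simpa using hl : algebraMap (ZMod p) F l ≠ 0)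
  have sign_p : quadraticChar (ZMod p) l ^ m = 1 ∨ quadraticChar (ZMod p) l ^ m = -1 := by
    rcases quadraticChar_dichotomy hl with h | h <;> rw [h]
    · simp
    · exact neg_one_pow_eq_or ℤ m
  have neg_one_ne_one : (-1 : F) ≠ 1 := Ring.neg_one_ne_one_of_char_ne_two hF
  rcases sign_F with h | h <;> rcases sign_p with h' | h' <;>
    rw [h, h'] at cast_eq ⊢ <;> push_cast at cast_eq
  · exact absurd cast_eq.symm neg_one_ne_one
  · exact absurd cast_eq neg_one_ne_one

theorem gaussSum_traceChar_sq [Fintype F] [DecidableEq F] (hp : p ≠ 2)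
    (hq : Fintype.card F = p ^ m) :
    gaussSum (castQuadraticChar F ℂ) (traceChar p F) ^ 2 =
      (quadraticChar (ZMod p) (-1) : ℂ) ^ m * (p : ℂ) ^ m := by
  have neg_one := quadraticChar_algebraMap (F := F) hp hq (l := -1) (by simp)
  rw [map_neg, map_one] at neg_one
  rw [gaussSum_sq (castQuadraticChar_ne_one (ringChar_ne_two_of_algebra_zmod hp))
    isQuadratic_castQuadraticChar isPrimitive_traceChar, hq, castQuadraticChar_apply, neg_one]
  push_cast
  rfl

end TraceCharacter

/-! ### Zeros of the trace of a quadratic polynomial -/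

section TraceZeroCount

variable {p m : ℕ} [Fact p.Prime] {F : Type*} [Field F] [Fintype F] [Algebra (ZMod p) F]

/-- The number of `x` in `F` with `Tr (g x) = 0`. When `g` is a polynomial function this is, up to
the factor `p`, the number of affine points of `y ^ p - y = g(x)`, and it is the number of zero
entries (including one at `x = 0`) of the codeword `Tr (g x)` when `g(0) = 0`. -/
noncomputable def traceZeroCount (p : ℕ) [Fact p.Prime] {F : Type*} [Field F] [Fintype F]
    [Algebra (ZMod p) F] (g : F → F) : ℕ :=
  Finset.card {x | Algebra.trace (ZMod p) F (g x) = 0}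

theorem traceZeroCount_comp_equiv (g : F → F) (σ : F ≃ F) :
    traceZeroCount p (fun x => g (σ x)) = traceZeroCount p g :=
  Finset.card_equiv σ fun x => by simp

theorem mul_traceZeroCount_eq_sum (g : F → F) :
    (p : ℂ) * traceZeroCount p g =
      ∑ l : ZMod p, ∑ a, traceChar p F (algebraMap (ZMod p) F l * g a) := by
  rw [Finset.sum_comm]
  simp only [traceChar_algebraMap_mul, AddChar.sum_mulShift _ (ZMod.isPrimitive_stdAddChar p),
    ZMod.card, Nat.cast_ite, Nat.cast_zero]
  rw [Finset.sum_ite, Finset.sum_const_zero, add_zero, Finset.sum_const, nsmul_eq_mul, mul_comm]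
  rfl

theorem mul_traceZeroCount_eq_pow_add_sum (hq : Fintype.card F = p ^ m) (g : F → F) :
    (p : ℂ) * traceZeroCount p g = (p : ℂ) ^ m +
      ∑ l ∈ Finset.univ.erase (0 : ZMod p), ∑ a, traceChar p F (algebraMap (ZMod p) F l * g a) := by
  rw [mul_traceZeroCount_eq_sum, ← Finset.add_sum_erase _ _ (Finset.mem_univ (0 : ZMod p))]
  simp [hq]

theorem mul_traceZeroCount_linear (hq : Fintype.card F = p ^ m) {a : F} (ha : a ≠ 0) (c : F) :
    p * traceZeroCount p (fun x => a * x + c) = p ^ m := by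
  have sum_eq_zero (l : ZMod p) (hl : l ≠ 0) :
      ∑ x, traceChar p F (algebraMap (ZMod p) F l * (a * x + c)) = 0 := by
    have hla : algebraMap (ZMod p) F l * a ≠ 0 := mul_ne_zero (by simpa using hl) ha
    have h := AddChar.sum_eq_zero_of_ne_one (isPrimitive_traceChar (p := p) hla)
    simp only [AddChar.mulShift_apply] at h
    simp only [mul_add, ← mul_assoc, AddChar.map_add_eq_mul, ← Finset.sum_mul, h, zero_mul]
  have h := mul_traceZeroCount_eq_pow_add_sum hq fun x : F => a * x + c
  rw [Finset.sum_eq_zero fun l hl => sum_eq_zero l (Finset.ne_of_mem_erase hl), add_zero] at h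
  exact_mod_cast h

theorem mul_traceZeroCount_quadratic [DecidableEq F] (hp : p ≠ 2) (hq : Fintype.card F = p ^ m)
    {b : F} (hb : b ≠ 0) (c : F) :
    (p : ℂ) * traceZeroCount p (fun x => b * x ^ 2 + c) =
      (p : ℂ) ^ m + quadraticChar F b * gaussSum (castQuadraticChar F ℂ) (traceChar p F) *
        ∑ l ∈ Finset.univ.erase (0 : ZMod p), (quadraticChar (ZMod p) l : ℂ) ^ m *
          ZMod.stdAddChar (N := p) (l * Algebra.trace (ZMod p) F c) := by
  rw [mul_traceZeroCount_eq_pow_add_sum hq, Finset.mul_sum]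
  congr 1
  refine Finset.sum_congr rfl fun l hl => ?_
  have hl0 : l ≠ 0 := Finset.ne_of_mem_erase hl
  have hlb : algebraMap (ZMod p) F l * b ≠ 0 := mul_ne_zero (by simpa using hl0) hb
  simp only [mul_add, ← mul_assoc, AddChar.map_add_eq_mul, ← Finset.sum_mul,
    traceChar_algebraMap_mul l c,
    sum_addChar_mul_sq (ringChar_ne_two_of_algebra_zmod hp) isPrimitive_traceChar hlb, map_mul,
    quadraticChar_algebraMap hp hq hl0]
  push_cast
  ring

theorem sum_quadraticChar_pow_mul_stdAddChar_of_even (hm : Even m) (t : ZMod p) :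
    ∑ l ∈ Finset.univ.erase (0 : ZMod p), (quadraticChar (ZMod p) l : ℂ) ^ m *
      ZMod.stdAddChar (N := p) (l * t) = if t = 0 then (p : ℂ) - 1 else -1 := by
  have pow_eq_one (l : ZMod p) (hl : l ∈ Finset.univ.erase 0) :
      (quadraticChar (ZMod p) l : ℂ) ^ m * ZMod.stdAddChar (N := p) (l * t) =
        ZMod.stdAddChar (N := p) (l * t) := by
    rcases quadraticChar_dichotomy (Finset.ne_of_mem_erase hl) with h | h <;>
      simp [h, hm.neg_one_pow]
  rw [Finset.sum_congr rfl pow_eq_one, Finset.sum_erase_eq_sub (Finset.mem_univ _),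
    AddChar.sum_mulShift t (ZMod.isPrimitive_stdAddChar p), zero_mul, AddChar.map_zero_eq_one,
    ZMod.card]
  split_ifs <;> simp

theorem sum_quadraticChar_pow_mul_stdAddChar_of_odd (hp : p ≠ 2) (hm : Odd m) (t : ZMod p) :
    ∑ l ∈ Finset.univ.erase (0 : ZMod p), (quadraticChar (ZMod p) l : ℂ) ^ m *
      ZMod.stdAddChar (N := p) (l * t) = quadraticChar (ZMod p) t *
        gaussSum (castQuadraticChar (ZMod p) ℂ) (ZMod.stdAddChar (N := p)) := by
  have sum_eq_gaussSum : ∑ l ∈ Finset.univ.erase (0 : ZMod p),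
      (quadraticChar (ZMod p) l : ℂ) ^ m * ZMod.stdAddChar (N := p) (l * t) =
        gaussSum (castQuadraticChar (ZMod p) ℂ) ((ZMod.stdAddChar (N := p)).mulShift t) := by
    rw [gaussSum, ← Finset.add_sum_erase _ _ (Finset.mem_univ (0 : ZMod p)),
      MulChar.map_zero, zero_mul, zero_add]
    refine Finset.sum_congr rfl fun l hl => ?_
    rw [AddChar.mulShift_apply, mul_comm l, castQuadraticChar_apply]
    rcases quadraticChar_dichotomy (Finset.ne_of_mem_erase hl) with h | h <;>
      simp [h, hm.neg_one_pow]
  rw [sum_eq_gaussSum]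
  by_cases ht : t = 0
  · rw [ht, AddChar.mulShift_zero, gaussSum_one_right
      (castQuadraticChar_ne_one (by rwa [ZMod.ringChar_zmod_n])), MulChar.map_zero]
    simp
  · exact gaussSum_castQuadraticChar_mulShift _ ht

theorem exists_units_int_mul_eq_of_sq_eq_sq {R : Type*} [CommRing R] [NoZeroDivisors R] {a b : R}
    (h : a ^ 2 = b ^ 2) : ∃ e : ℤˣ, a = (e : ℤ) * b := by
  rcases sq_eq_sq_iff_eq_or_eq_neg.1 h with h | h
  · exact ⟨1, by simp [h]⟩
  · exact ⟨-1, by simp [h]⟩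

theorem exists_gaussSum_eq_of_even [DecidableEq F] (hp : p ≠ 2) (hq : Fintype.card F = p ^ m)
    (hm : Even m) :
    ∃ e : ℤˣ, gaussSum (castQuadraticChar F ℂ) (traceChar p F) = (e : ℤ) * (p : ℂ) ^ (m / 2) := by
  apply exists_units_int_mul_eq_of_sq_eq_sq
  rw [gaussSum_traceChar_sq hp hq, ← pow_mul, Nat.div_mul_cancel hm.two_dvd]
  rcases quadraticChar_dichotomy (F := ZMod p) (a := -1) (by simp) with h | h <;>
    simp [h, hm.neg_one_pow]

theorem exists_gaussSum_mul_gaussSum_eq_of_odd [DecidableEq F] (hp : p ≠ 2)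
    (hq : Fintype.card F = p ^ m) (hm : Odd m) :
    ∃ e : ℤˣ, gaussSum (castQuadraticChar F ℂ) (traceChar p F) *
      gaussSum (castQuadraticChar (ZMod p) ℂ) (ZMod.stdAddChar (N := p)) =
        (e : ℤ) * (p : ℂ) ^ ((m + 1) / 2) := by
  apply exists_units_int_mul_eq_of_sq_eq_sq
  rw [mul_pow, gaussSum_traceChar_sq hp hq,
    gaussSum_sq (castQuadraticChar_ne_one (by rwa [ZMod.ringChar_zmod_n]))
      isQuadratic_castQuadraticChar (ZMod.isPrimitive_stdAddChar p),
    ← pow_mul, Nat.div_mul_cancel hm.add_one.two_dvd, castQuadraticChar_apply, ZMod.card,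
    pow_succ (p : ℂ)]
  rcases quadraticChar_dichotomy (F := ZMod p) (a := -1) (by simp) with h | h <;>
    simp [h, hm.neg_one_pow]

theorem exists_mul_traceZeroCount_quadratic_of_even [DecidableEq F] (hp : p ≠ 2)
    (hq : Fintype.card F = p ^ m) (hm : Even m) :
    ∃ e : ℤˣ, ∀ b c : F, b ≠ 0 → (p : ℤ) * traceZeroCount p (fun x => b * x ^ 2 + c) =
      (p : ℤ) ^ m + e * quadraticChar F b * (p : ℤ) ^ (m / 2) *
        (if Algebra.trace (ZMod p) F c = 0 then (p : ℤ) - 1 else -1) := by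
  obtain ⟨e, he⟩ := exists_gaussSum_eq_of_even hp hq hm
  refine ⟨e, fun b c hb => ?_⟩
  rw [← Int.cast_inj (α := ℂ)]
  push_cast
  rw [mul_traceZeroCount_quadratic hp hq hb, sum_quadraticChar_pow_mul_stdAddChar_of_even hm, he]
  ring

theorem exists_mul_traceZeroCount_quadratic_of_odd [DecidableEq F] (hp : p ≠ 2)
    (hq : Fintype.card F = p ^ m) (hm : Odd m) :
    ∃ e : ℤˣ, ∀ b c : F, b ≠ 0 → (p : ℤ) * traceZeroCount p (fun x => b * x ^ 2 + c) =
      (p : ℤ) ^ m + e * quadraticChar F b * (p : ℤ) ^ ((m + 1) / 2) *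
        quadraticChar (ZMod p) (Algebra.trace (ZMod p) F c) := by
  obtain ⟨e, he⟩ := exists_gaussSum_mul_gaussSum_eq_of_odd hp hq hm
  refine ⟨e, fun b c hb => ?_⟩
  rw [← Int.cast_inj (α := ℂ)]
  push_cast
  rw [mul_traceZeroCount_quadratic hp hq hb,
    sum_quadraticChar_pow_mul_stdAddChar_of_odd hp hm]
  linear_combination (quadraticChar F b : ℂ) *
    (quadraticChar (ZMod p) (Algebra.trace (ZMod p) F c) : ℂ) * he

end TraceZeroCount

section ExtremalCount

variable {p m : ℕ} [Fact p.Prime] {F : Type*} [Field F] [Fintype F] [Algebra (ZMod p) F]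

/-- The largest excess over `q = p ^ m` of the number of affine points of `y ^ p - y = f(x)`
over the field with `q` elements, for `f` of degree two. -/
def quadraticExcess (p m : ℕ) : ℤ :=
  if Even m then ((p : ℤ) - 1) * (p : ℤ) ^ (m / 2) else (p : ℤ) ^ ((m + 1) / 2)

theorem quadraticExcess_pos (p m : ℕ) [hp : Fact p.Prime] : 0 < quadraticExcess p m := by
  have one_lt : (1 : ℤ) < p := mod_cast hp.out.one_lt
  unfold quadraticExcess
  split_ifs
  · exact mul_pos (by omega) (by positivity)
  · positivity

theorem pow_add_quadraticExcess_lt (hp : p ≠ 2) (hm : m ≠ 0) :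
    (p : ℤ) ^ m + quadraticExcess p m < p * (p : ℤ) ^ m := by
  have hp3 : (3 : ℤ) ≤ p := by
    have := (Fact.out : p.Prime).two_le
    omega
  have pow_le {k : ℕ} (hk : k ≤ m) : (p : ℤ) ^ k ≤ (p : ℤ) ^ m :=
    pow_le_pow_right₀ (by omega) hk
  have zero_lt_pow : (0 : ℤ) < (p : ℤ) ^ m := by positivity
  unfold quadraticExcess
  split_ifs
  · have : (p : ℤ) ^ (m / 2) < (p : ℤ) ^ m := pow_lt_pow_right₀ (by omega) (by omega)
    nlinarith
  · nlinarith [pow_le (k := (m + 1) / 2) (by omega)]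

theorem exists_eval_eq_leadingCoeff_mul_sub_sq_add {K : Type*} [Field K] [NeZero (2 : K)]
    {f : K[X]} (hf : f.natDegree = 2) :
    ∃ v, ∀ x, f.eval x = f.leadingCoeff * (x - v) ^ 2 + f.eval v := by
  have hlc : f.coeff 2 ≠ 0 := by
    rw [← hf]
    exact Polynomial.leadingCoeff_ne_zero.2 (Polynomial.ne_zero_of_natDegree_gt (n := 0) (by omega))
  refine ⟨-f.coeff 1 / (2 * f.coeff 2), fun x => ?_⟩
  have h2 : (2 : K) ≠ 0 := NeZero.ne 2
  simp only [Polynomial.eval_eq_sum_range, Polynomial.leadingCoeff, hf, Finset.sum_range_succ,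
    Finset.sum_range_zero]
  field_simp
  ring

theorem exists_traceZeroCount_eval_eq (hp : p ≠ 2) {f : F[X]} (hf : f.natDegree = 2) :
    ∃ c, traceZeroCount p (fun x => f.eval x) =
      traceZeroCount p (fun x => f.leadingCoeff * x ^ 2 + c) := by
  have : NeZero (2 : F) := ⟨Ring.two_ne_zero (ringChar_ne_two_of_algebra_zmod hp)⟩
  obtain ⟨v, hv⟩ := exists_eval_eq_leadingCoeff_mul_sub_sq_add hf
  refine ⟨f.eval v, ?_⟩
  rw [show (fun x => f.eval x) = _ from funext hv]
  exact traceZeroCount_comp_equiv (p := p) (fun x => f.leadingCoeff * x ^ 2 + f.eval v)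
    (Equiv.subRight v)

theorem mul_traceZeroCount_eval_le_of_natDegree_eq_two (hp : p ≠ 2)
    (hq : Fintype.card F = p ^ m) {f : F[X]} (hf : f.natDegree = 2) :
    (p : ℤ) * traceZeroCount p (fun x => f.eval x) ≤ (p : ℤ) ^ m + quadraticExcess p m := by
  classical
  have one_lt : (1 : ℤ) < p := mod_cast (Fact.out : p.Prime).one_lt
  have hlc : f.leadingCoeff ≠ 0 := by
    rw [Polynomial.leadingCoeff_ne_zero]
    exact Polynomial.ne_zero_of_natDegree_gt (n := 0) (by omega)
  obtain ⟨c, hc⟩ := exists_traceZeroCount_eval_eq hp hf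
  rw [hc, quadraticExcess]
  split_ifs with hm
  · obtain ⟨e, he⟩ := exists_mul_traceZeroCount_quadratic_of_even (F := F) hp hq hm
    have zero_lt_pow : (0 : ℤ) < (p : ℤ) ^ (m / 2) := by positivity
    rw [he _ c hlc]
    rcases Int.units_eq_one_or e with rfl | rfl <;>
      rcases quadraticChar_dichotomy hlc with hχ | hχ <;>
      rw [hχ] <;> split_ifs <;> push_cast <;> nlinarith
  · obtain ⟨e, he⟩ :=
      exists_mul_traceZeroCount_quadratic_of_odd (F := F) hp hq (Nat.not_even_iff_odd.1 hm)
    have zero_lt_pow : (0 : ℤ) < (p : ℤ) ^ ((m + 1) / 2) := by positivity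
    rw [he _ c hlc]
    rcases Int.units_eq_one_or e with rfl | rfl <;>
      rcases quadraticChar_dichotomy hlc with hχ | hχ <;>
      rcases quadraticChar_isQuadratic (ZMod p) (Algebra.trace (ZMod p) F c) with ht | ht | ht <;>
      rw [hχ, ht] <;> push_cast <;> linarith

theorem mul_traceZeroCount_eval_le (hp : p ≠ 2) (hq : Fintype.card F = p ^ m) {f : F[X]}
    (hf : f.natDegree ≤ 2) (hcount : traceZeroCount p (fun x => f.eval x) < Fintype.card F) :
    (p : ℤ) * traceZeroCount p (fun x => f.eval x) ≤ (p : ℤ) ^ m + quadraticExcess p m := by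
  have hpos := quadraticExcess_pos p m
  obtain h | h | h : f.natDegree = 0 ∨ f.natDegree = 1 ∨ f.natDegree = 2 := by omega
  · obtain ⟨c, rfl⟩ := Polynomial.natDegree_eq_zero.1 h
    have hc : Algebra.trace (ZMod p) F c ≠ 0 := by
      intro hc
      simp only [traceZeroCount, Polynomial.eval_C, hc, Finset.filter_true, Finset.card_univ,
        lt_irrefl] at hcount
    simp only [traceZeroCount, Polynomial.eval_C, hc, Finset.filter_false, Finset.card_empty]
    push_cast
    positivity
  · obtain ⟨a, ha, c, rfl⟩ := Polynomial.natDegree_eq_one.1 h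
    have := mul_traceZeroCount_linear (p := p) hq ha c
    simp only [Polynomial.eval_add, Polynomial.eval_mul, Polynomial.eval_C, Polynomial.eval_X]
    zify at this
    linarith
  · exact mul_traceZeroCount_eval_le_of_natDegree_eq_two hp hq h

theorem exists_mul_traceZeroCount_quadratic_eq (hp : p ≠ 2) (hq : Fintype.card F = p ^ m) :
    ∃ b c : F, b ≠ 0 ∧ (p : ℤ) * traceZeroCount p (fun x => b * x ^ 2 + c) =
      (p : ℤ) ^ m + quadraticExcess p m := by
  classical
  unfold quadraticExcess
  split_ifs with hm
  · obtain ⟨e, he⟩ := exists_mul_traceZeroCount_quadratic_of_even (F := F) hp hq hm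
    obtain ⟨b, hb⟩ := exists_quadraticChar_eq_units (ringChar_ne_two_of_algebra_zmod (F := F) hp) e
    have hb0 : b ≠ 0 := by
      rintro rfl
      simp [eq_comm] at hb
    refine ⟨b, 0, hb0, ?_⟩
    rw [he b 0 hb0, hb, map_zero, if_pos rfl, Int.units_coe_mul_self]
    ring
  · obtain ⟨e, he⟩ :=
      exists_mul_traceZeroCount_quadratic_of_odd (F := F) hp hq (Nat.not_even_iff_odd.1 hm)
    obtain ⟨t, ht⟩ := exists_quadraticChar_eq_units (F := ZMod p) (by rwa [ZMod.ringChar_zmod_n]) e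
    obtain ⟨c, rfl⟩ := Algebra.trace_surjective (ZMod p) F t
    refine ⟨1, c, one_ne_zero, ?_⟩
    rw [he 1 c one_ne_zero, ht, map_one, mul_one, mul_right_comm, Int.units_coe_mul_self, one_mul]

theorem exists_natDegree_eq_two_and_mul_traceZeroCount_eq (hp : p ≠ 2)
    (hq : Fintype.card F = p ^ m) :
    ∃ f : F[X], f.natDegree = 2 ∧ (p : ℤ) * traceZeroCount p (fun x => f.eval x) =
      (p : ℤ) ^ m + quadraticExcess p m := by
  obtain ⟨b, c, hb, h⟩ := exists_mul_traceZeroCount_quadratic_eq (F := F) hp hq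
  refine ⟨Polynomial.C b * Polynomial.X ^ 2 + Polynomial.C c, ?_, by simpa using h⟩
  rw [Polynomial.natDegree_add_C, Polynomial.natDegree_C_mul_X_pow 2 b hb]

end ExtremalCount

/-! ### The minimum distance of the power code -/

section PowerCode

variable {p m : ℕ} [Fact p.Prime] {F : Type*} [Field F] [Algebra (ZMod p) F]

/-- The word `(Tr (f x))` indexed by the nonzero elements `x` of `F`, as a linear function of the
polynomial `f`. -/
noncomputable def traceWord (p : ℕ) [Fact p.Prime] (F : Type*) [Field F] [Algebra (ZMod p) F] :
    F[X] →ₗ[ZMod p] (Fˣ → ZMod p) :=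
  LinearMap.pi fun x =>
    Algebra.trace (ZMod p) F ∘ₗ (Polynomial.leval (x : F)).restrictScalars (ZMod p)

theorem traceWord_apply (f : F[X]) (x : Fˣ) :
    traceWord p F f x = Algebra.trace (ZMod p) F (f.eval (x : F)) := rfl

theorem exists_trace_mul_eq [Finite F] (l : F →ₗ[ZMod p] ZMod p) :
    ∃ a : F, ∀ x, l x = Algebra.trace (ZMod p) F (a * x) := by
  obtain ⟨a, rfl⟩ := ((Algebra.traceForm (ZMod p) F).toDual
    (traceForm_nondegenerate (ZMod p) F)).surjective l
  exact ⟨a, fun _ => rfl⟩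

theorem exists_powerMatrix_eq_traceWord [Finite F] (φ : F ≃ₗ[ZMod p] (Fin m → ZMod p)) {r : ℕ}
    (i : Fin r) (j : Fin m) :
    ∃ a : F, powerMatrix φ r (i, j) =
      traceWord p F (Polynomial.C a * Polynomial.X ^ ((i : ℕ) + 1)) := by
  obtain ⟨a, ha⟩ := exists_trace_mul_eq (LinearMap.proj j ∘ₗ φ.toLinearMap)
  refine ⟨a, funext fun x => ?_⟩
  simpa [powerMatrix, traceWord_apply] using ha ((x : F) ^ ((i : ℕ) + 1))

theorem traceWord_C_mul_X_pow_mem_powerCode (φ : F ≃ₗ[ZMod p] (Fin m → ZMod p)) {r : ℕ} (a : F)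
    (i : Fin r) :
    traceWord p F (Polynomial.C a * Polynomial.X ^ ((i : ℕ) + 1)) ∈ powerCode φ r := by
  let l : (Fin m → ZMod p) →ₗ[ZMod p] ZMod p :=
    (Algebra.trace (ZMod p) F ∘ₗ LinearMap.mulLeft (ZMod p) a) ∘ₗ φ.symm.toLinearMap
  have eq_sum : traceWord p F (Polynomial.C a * Polynomial.X ^ ((i : ℕ) + 1)) =
      ∑ j, l (fun k => if j = k then 1 else 0) • powerMatrix φ r (i, j) := by
    funext x
    have trace_eq : traceWord p F (Polynomial.C a * Polynomial.X ^ ((i : ℕ) + 1)) x =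
        l (φ ((x : F) ^ ((i : ℕ) + 1))) := by simp [l, traceWord_apply]
    rw [trace_eq, LinearMap.pi_apply_eq_sum_univ l]
    simp [powerMatrix, mul_comm]
  rw [eq_sum]
  exact Submodule.sum_mem _ fun j _ =>
    Submodule.smul_mem _ _ (Submodule.subset_span ⟨(i, j), rfl⟩)

theorem mem_powerCode_iff [Finite F] (φ : F ≃ₗ[ZMod p] (Fin m → ZMod p)) {r : ℕ}
    {w : Fˣ → ZMod p} :
    w ∈ powerCode φ r ↔
      ∃ f : F[X], f.natDegree ≤ r ∧ f.coeff 0 = 0 ∧ traceWord p F f = w := by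
  constructor
  · intro hw
    induction hw using Submodule.span_induction with
    | mem w hw =>
      obtain ⟨⟨i, j⟩, rfl⟩ := hw
      obtain ⟨a, ha⟩ := exists_powerMatrix_eq_traceWord φ i j
      exact ⟨_, (Polynomial.natDegree_C_mul_X_pow_le a _).trans i.2, by simp, ha.symm⟩
    | zero => exact ⟨0, by simp, by simp, map_zero _⟩
    | add u w _ _ hu hw =>
      obtain ⟨f, hf, hf0, rfl⟩ := hu
      obtain ⟨g, hg, hg0, rfl⟩ := hw
      exact ⟨f + g, Polynomial.natDegree_add_le_of_degree_le hf hg, by simp [hf0, hg0],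
        map_add _ f g⟩
    | smul c w _ hw =>
      obtain ⟨f, hf, hf0, rfl⟩ := hw
      exact ⟨c • f, (Polynomial.natDegree_smul_le c f).trans hf, by simp [hf0], map_smul _ c f⟩
  · rintro ⟨f, hf, hf0, rfl⟩
    rw [f.as_sum_range_C_mul_X_pow' (Nat.lt_succ_of_le hf), Finset.sum_range_succ', hf0,
      Polynomial.C_0, zero_mul, add_zero, map_sum]
    exact Submodule.sum_mem _ fun i hi =>
      traceWord_C_mul_X_pow_mem_powerCode φ _ ⟨i, Finset.mem_range.1 hi⟩

theorem hammingNorm_restrict_units_add_card_zeros [Fintype F] [DecidableEq F] {k : Type*} [Zero k]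
    [DecidableEq k] {g : F → k} (hg : g 0 = 0) :
    hammingNorm (fun x : Fˣ => g x) + Finset.card {x | g x = 0} = Fintype.card F := by
  have hnorm : hammingNorm (fun x : Fˣ => g x) = Finset.card {x | ¬g x = 0} :=
    Finset.card_bij (fun x _ => (x : F)) (fun x hx => by simpa using hx)
      (fun x _ y _ h => Units.ext h) fun y hy => by
        have hy0 : y ≠ 0 := by
          rintro rfl
          simp [hg] at hy
        exact ⟨Units.mk0 y hy0, by simpa using hy, rfl⟩
  rw [hnorm, add_comm, Finset.card_filter_add_card_filter_not, Finset.card_univ]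

variable [Fintype F]

theorem hammingNorm_traceWord_add_traceZeroCount [DecidableEq F] {f : F[X]} (hf : f.coeff 0 = 0) :
    hammingNorm (traceWord p F f) + traceZeroCount p (fun x => f.eval x) = Fintype.card F :=
  hammingNorm_restrict_units_add_card_zeros (g := fun x => Algebra.trace (ZMod p) F (f.eval x))
    (by rw [← Polynomial.coeff_zero_eq_eval_zero, hf, map_zero])

theorem exists_coeff_zero_eq_zero_and_traceZeroCount_eq {f : F[X]}
    (hf : 0 < traceZeroCount p (fun x => f.eval x)) :
    ∃ g : F[X], g.natDegree = f.natDegree ∧ g.coeff 0 = 0 ∧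
      traceZeroCount p (fun x => g.eval x) = traceZeroCount p (fun x => f.eval x) := by
  obtain ⟨a, ha⟩ := Finset.card_pos.1 hf
  replace ha : Algebra.trace (ZMod p) F (f.eval a) = 0 := by simpa using ha
  refine ⟨f.comp (Polynomial.X + Polynomial.C a) - Polynomial.C (f.eval a), ?_, ?_, ?_⟩
  · rw [Polynomial.natDegree_sub_C, Polynomial.natDegree_comp, Polynomial.natDegree_X_add_C,
      mul_one]
  · simp [Polynomial.coeff_zero_eq_eval_zero]
  · exact Finset.card_equiv (Equiv.addRight a) fun x => by simp [ha]

theorem minDistance_powerCode_add_traceZeroCount_eq [DecidableEq F]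
    (φ : F ≃ₗ[ZMod p] (Fin m → ZMod p)) {r : ℕ} {f : F[X]} (hf : f.natDegree ≤ r)
    (hpos : 0 < traceZeroCount p (fun x => f.eval x))
    (hlt : traceZeroCount p (fun x => f.eval x) < Fintype.card F)
    (hmax : ∀ g : F[X], g.natDegree ≤ r → traceZeroCount p (fun x => g.eval x) < Fintype.card F →
      traceZeroCount p (fun x => g.eval x) ≤ traceZeroCount p (fun x => f.eval x)) :
    minDistance (powerCode φ r) + traceZeroCount p (fun x => f.eval x) = Fintype.card F := by
  have count_lt {g : F[X]} (hg : g.coeff 0 = 0) :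
      traceWord p F g ≠ 0 ↔ traceZeroCount p (fun x => g.eval x) < Fintype.card F := by
    have := hammingNorm_traceWord_add_traceZeroCount (p := p) hg
    rw [← hammingNorm_pos_iff]
    omega
  obtain ⟨g, hgdeg, hg0, hgf⟩ := exists_coeff_zero_eq_zero_and_traceZeroCount_eq hpos
  rw [← hgf] at hlt hmax ⊢
  have isLeast : IsLeast {w | ∃ c ∈ powerCode φ r, c ≠ 0 ∧ hammingNorm c = w}
      (hammingNorm (traceWord p F g)) := by
    refine ⟨⟨_, (mem_powerCode_iff φ).2 ⟨g, hgdeg.trans_le hf, hg0, rfl⟩, (count_lt hg0).2 hlt,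
      rfl⟩, ?_⟩
    rintro _ ⟨c, hc, hc0, rfl⟩
    obtain ⟨h, hdeg, hh0, rfl⟩ := (mem_powerCode_iff φ).1 hc
    have := hmax h hdeg ((count_lt hh0).1 hc0)
    have := hammingNorm_traceWord_add_traceZeroCount (p := p) hg0
    have := hammingNorm_traceWord_add_traceZeroCount (p := p) hh0
    omega
  rw [minDistance, isLeast.csInf_eq, hammingNorm_traceWord_add_traceZeroCount hg0]

theorem codeBound_two_eq [DecidableEq F] (hp : p ≠ 2) (hq : Fintype.card F = p ^ m)
    (φ : F ≃ₗ[ZMod p] (Fin m → ZMod p)) :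
    codeBound φ 2 = (p : ℤ) ^ m + 1 + quadraticExcess p m := by
  have hp0 : (0 : ℤ) < p := mod_cast (Fact.out : p.Prime).pos
  have hm : m ≠ 0 := by
    rintro rfl
    exact (Fintype.one_lt_card (α := F)).ne' (by simpa using hq)
  have hexcess := quadraticExcess_pos p m
  obtain ⟨f, hf, hcount⟩ := exists_natDegree_eq_two_and_mul_traceZeroCount_eq (F := F) hp hq
  have hdist := minDistance_powerCode_add_traceZeroCount_eq φ hf.le
    (by zify; exact pos_of_mul_pos_right (by rw [hcount]; positivity) hp0.le)
    (by
      rw [hq]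
      zify
      exact lt_of_mul_lt_mul_left (hcount.trans_lt (pow_add_quadraticExcess_lt hp hm)) hp0.le)
    (fun g hg hglt => by
      zify
      exact le_of_mul_le_mul_left
        ((mul_traceZeroCount_eval_le hp hq hg hglt).trans_eq hcount.symm) hp0)
  rw [hq] at hdist
  zify at hdist
  unfold codeBound
  linear_combination hcount - p * hdist

end PowerCode

/-! ### Affine points -/

section ArtinSchreierMap

variable {p : ℕ} [Fact p.Prime] {F : Type*} [Field F] [Algebra (ZMod p) F]

/-- The Artin–Schreier map `b ↦ b ^ p - b`, linear over the prime field. -/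
noncomputable def artinSchreierMap (p : ℕ) [Fact p.Prime] (F : Type*) [Field F]
    [Algebra (ZMod p) F] : F →ₗ[ZMod p] F :=
  (FiniteField.frobeniusAlgHom (ZMod p) F).toLinearMap - LinearMap.id

theorem artinSchreierMap_apply (b : F) : artinSchreierMap p F b = b ^ p - b := by
  simp [artinSchreierMap, ZMod.card]

theorem card_ker_artinSchreierMap : Nat.card (LinearMap.ker (artinSchreierMap p F)) = p := by
  have : CharP F p := charP_of_injective_algebraMap' (ZMod p) p
  have ker_eq : (LinearMap.ker (artinSchreierMap p F) : Set F) = ((⊥ : Subfield F) : Set F) := by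
    ext x
    simp [artinSchreierMap_apply, Subfield.mem_bot_iff_pow_eq_self F p, sub_eq_zero]
  exact (Nat.card_congr (Equiv.setCongr ker_eq)).trans (Subfield.card_bot F p)

theorem range_artinSchreierMap [Finite F] :
    LinearMap.range (artinSchreierMap p F) = LinearMap.ker (Algebra.trace (ZMod p) F) := by
  apply Submodule.eq_of_le_of_finrank_eq
  · rintro _ ⟨b, rfl⟩
    rw [LinearMap.mem_ker, artinSchreierMap_apply, map_sub, sub_eq_zero]
    simpa [FiniteField.coe_frobeniusAlgEquivOfAlgebraic, ZMod.card] using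
      Algebra.trace_eq_of_algEquiv (FiniteField.frobeniusAlgEquivOfAlgebraic (ZMod p) F) b
  · have finrank_ker : Module.finrank (ZMod p) (LinearMap.ker (artinSchreierMap p F)) = 1 := by
      have h := Module.natCard_eq_pow_finrank (K := ZMod p)
        (V := LinearMap.ker (artinSchreierMap p F))
      rw [card_ker_artinSchreierMap, Nat.card_zmod] at h
      exact (Nat.pow_right_injective (Fact.out : p.Prime).two_le (by simpa using h)).symm
    have rank_nullity := LinearMap.finrank_range_add_finrank_ker (artinSchreierMap p F)
    have rank_nullity_trace :=
      LinearMap.finrank_range_add_finrank_ker (Algebra.trace (ZMod p) F)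
    rw [LinearMap.range_eq_top.2 (Algebra.trace_surjective (ZMod p) F), finrank_top,
      Module.finrank_self] at rank_nullity_trace
    omega

theorem card_artinSchreier_fibre [Fintype F] [DecidableEq F] (c : F) :
    Finset.card {b : F | b ^ p - b = c} = if Algebra.trace (ZMod p) F c = 0 then p else 0 := by
  have mem_range_iff : c ∈ LinearMap.range (artinSchreierMap p F) ↔
      Algebra.trace (ZMod p) F c = 0 := by rw [range_artinSchreierMap, LinearMap.mem_ker]
  split_ifs with h
  · obtain ⟨b₀, hb₀⟩ := mem_range_iff.2 h
    rw [← Fintype.card_subtype, ← Nat.card_eq_fintype_card]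
    refine Eq.trans ?_ (card_ker_artinSchreierMap (p := p) (F := F))
    refine Nat.card_congr ((Equiv.subRight b₀).subtypeEquiv fun b => ?_)
    rw [Equiv.subRight_apply, LinearMap.mem_ker, map_sub, hb₀, artinSchreierMap_apply, sub_eq_zero]
  · rw [Finset.card_eq_zero, Finset.filter_eq_empty_iff]
    exact fun b _ hb => h (mem_range_iff.1 ⟨b, (artinSchreierMap_apply b).trans hb⟩)

/-- The affine rational points of the curve `y ^ p - y = f(x)`. -/
def affinePoints (p : ℕ) {F : Type*} [Field F] (f : F[X]) : Set (F × F) :=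
  {P | P.2 ^ p - P.2 = f.eval P.1}

theorem ncard_affinePoints [Fintype F] (f : F[X]) :
    (affinePoints p f).ncard = p * traceZeroCount p (fun x => f.eval x) := by
  have := Classical.decEq F
  have coe_filter : affinePoints p f =
      (({P | P.2 ^ p - P.2 = f.eval P.1} : Finset (F × F)) : Set (F × F)) := by
    ext
    simp [affinePoints]
  rw [coe_filter, Set.ncard_coe_finset, ← Finset.univ_product_univ, Finset.card_filter,
    Finset.sum_product]
  simp only [← Finset.card_filter, card_artinSchreier_fibre]
  rw [Finset.sum_ite, Finset.sum_const_zero, add_zero, Finset.sum_const, smul_eq_mul, mul_comm]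
  rfl

end ArtinSchreierMap

/-! ### Places -/

namespace Place

variable {F E : Type*} [Field F] [Field E] [Algebra F E]

theorem ext_ring {P Q : Place F E} (h : P.ring = Q.ring) : P = Q := by
  cases P; cases Q; cases h; rfl

theorem valuation_algebraMap (P : Place F E) {c : F} (hc : c ≠ 0) :
    P.ring.valuation (algebraMap F E c) = 1 := by
  refine le_antisymm ((P.ring.valuation_le_one_iff _).2 (P.algebraMap_mem c)) ?_
  have inv_le_one := (P.ring.valuation_le_one_iff _).2 (P.algebraMap_mem c⁻¹)
  have valuation_ne_zero : P.ring.valuation (algebraMap F E c) ≠ 0 := by simpa using hc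
  rwa [map_inv₀, map_inv₀, inv_le_one₀ (zero_lt_iff.2 valuation_ne_zero)] at inv_le_one

theorem algebraMap_mem_nonunits_iff (P : Place F E) {c : F} :
    algebraMap F E c ∈ P.ring.nonunits ↔ c = 0 := by
  rw [ValuationSubring.mem_nonunits_iff]
  constructor
  · intro h
    by_contra hc
    exact h.ne (P.valuation_algebraMap hc)
  · rintro rfl
    simp

theorem one_lt_valuation (P : Place F E) {x : E} (hx : x ∉ P.ring) : 1 < P.ring.valuation x := by
  rwa [← not_le, P.ring.valuation_le_one_iff]

theorem mem_of_sub_mem_nonunits (P : Place F E) {z : E} {c : F}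
    (h : z - algebraMap F E c ∈ P.ring.nonunits) : z ∈ P.ring := by
  have := add_mem (P.ring.nonunits_subset h) (P.algebraMap_mem c)
  rwa [sub_add_cancel] at this

theorem mul_mem_nonunits (P : Place F E) {z w : E} (hz : z ∈ P.ring.nonunits)
    (hw : w ∈ P.ring) : z * w ∈ P.ring.nonunits := by
  rw [ValuationSubring.mem_nonunits_iff] at hz ⊢
  rw [map_mul]
  exact mul_lt_one_of_lt_of_le hz ((P.ring.valuation_le_one_iff w).2 hw)

theorem degree_eq_one_iff (P : Place F E) :
    P.degree = 1 ↔ ∀ z ∈ P.ring, ∃ c : F, z - algebraMap F E c ∈ P.ring.nonunits := by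
  have residue_eq_iff (z : P.ring) (c : F) :
      algebraMap F (IsLocalRing.ResidueField P.ring) c = IsLocalRing.residue P.ring z ↔
        (z : E) - algebraMap F E c ∈ P.ring.nonunits := by
    have coe_sub : (z : E) - algebraMap F E c = ((z - algebraMap F P.ring c : P.ring) : E) := rfl
    rw [coe_sub, ValuationSubring.coe_mem_nonunits_iff, ← IsLocalRing.residue_eq_zero_iff, map_sub,
      sub_eq_zero, eq_comm]
    rfl
  rw [degree, Algebra.finrank_eq_one_iff_bijective_algebraMap, Function.Bijective,
    and_iff_right (algebraMap F (IsLocalRing.ResidueField P.ring)).injective, Function.Surjective,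
    IsLocalRing.residue_surjective.forall]
  simp only [residue_eq_iff, Subtype.forall]

theorem valuation_artinSchreier (P : Place F E) {p : ℕ} (hp : 1 < p) {y : E} (hy : y ∉ P.ring) :
    P.ring.valuation (y ^ p - y) = P.ring.valuation y ^ p := by
  rw [← map_pow]
  apply Valuation.map_sub_eq_of_lt_left
  rw [map_pow]
  exact lt_self_pow₀ (P.one_lt_valuation hy) hp

theorem exists_notMem {x : E} (hx : Transcendental F x) : ∃ P : Place F E, x ∉ P.ring := by
  have notMem : x ∉ (integralClosure F E).toSubring := fun h => hx h.isAlgebraic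
  have : IsIntegrallyClosedIn (integralClosure F E).toSubring E :=
    inferInstanceAs (IsIntegrallyClosedIn (integralClosure F E) E)
  obtain ⟨V, hV, hxV⟩ := Subring.exists_le_valuationSubring_of_isIntegrallyClosedIn notMem
  exact ⟨⟨V, fun a => hV ((integralClosure F E).algebraMap_mem a),
    fun h => hxV (h ▸ ValuationSubring.mem_top x)⟩, hxV⟩

/-- `u` and `w` have the same leading term at the place `P`: `w ≠ 0` and `u / w` has residue `1`. -/
def IsEquivalent (P : Place F E) (u w : E) : Prop :=
  P.ring.valuation (u - w) < P.ring.valuation w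

namespace IsEquivalent

variable {P : Place F E} {u w u' w' t : E}

theorem valuation_eq (h : P.IsEquivalent u w) : P.ring.valuation u = P.ring.valuation w :=
  Valuation.map_eq_of_sub_lt _ h

theorem valuation_right_pos (h : P.IsEquivalent u w) : 0 < P.ring.valuation w :=
  zero_le.trans_lt h

theorem add_of_lt (h : P.IsEquivalent u w) (ht : P.ring.valuation t < P.ring.valuation w) :
    P.IsEquivalent (u + t) w := by
  rw [IsEquivalent, add_sub_right_comm]
  exact Valuation.map_add_lt _ h ht

theorem mul_right (h : P.IsEquivalent u w) (ht : t ≠ 0) : P.IsEquivalent (u * t) (w * t) := by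
  rw [IsEquivalent, ← sub_mul, map_mul, map_mul]
  exact mul_lt_mul_of_pos_right h (zero_lt_iff.2 (by simpa using ht))

theorem div (h : P.IsEquivalent u w) (h' : P.IsEquivalent u' w') :
    P.IsEquivalent (u / u') (w / w') := by
  have hu' : 0 < P.ring.valuation u' := h'.valuation_eq ▸ h'.valuation_right_pos
  have hw' := h'.valuation_right_pos
  have sub_eq : u / u' - w / w' = ((u - w) * w' - w * (u' - w')) / (u' * w') := by
    have : u' ≠ 0 := by simpa using hu'.ne'
    have : w' ≠ 0 := by simpa using hw'.ne'
    field_simp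
    ring
  rw [IsEquivalent, sub_eq, map_div₀, map_div₀, map_mul, h'.valuation_eq,
    div_lt_iff₀ (by positivity), ← mul_assoc, div_mul_cancel₀ _ hw'.ne']
  refine Valuation.map_sub_lt _ ?_ ?_
  · rw [map_mul]
    exact mul_lt_mul_of_pos_right h hw'
  · rw [map_mul]
    exact mul_lt_mul_of_pos_left h' h.valuation_right_pos

end IsEquivalent

theorem isEquivalent_aeval (P : Place F E) {x : E} (hx : x ∉ P.ring) {g : F[X]} (hg : g ≠ 0) :
    P.IsEquivalent (Polynomial.aeval x g) (algebraMap F E g.leadingCoeff * x ^ g.natDegree) := by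
  have one_lt := P.one_lt_valuation hx
  have sub_eq : Polynomial.aeval x g - algebraMap F E g.leadingCoeff * x ^ g.natDegree =
      Polynomial.aeval x g.eraseLead := by
    rw [sub_eq_iff_eq_add]
    conv_lhs => rw [← g.eraseLead_add_C_mul_X_pow, map_add, map_mul, Polynomial.aeval_C, map_pow,
      Polynomial.aeval_X]
  rw [IsEquivalent, sub_eq, map_mul, P.valuation_algebraMap (by simpa using hg), one_mul, map_pow,
    Polynomial.aeval_eq_sum_range' (n := g.natDegree + 1)
      (Nat.lt_succ_of_le g.eraseLead_natDegree_le_aux)]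
  refine Valuation.map_sum_lt _ (pow_ne_zero _ (zero_lt_one.trans one_lt).ne') fun i hi => ?_
  by_cases hi0 : g.eraseLead.coeff i = 0
  · rw [hi0, zero_smul, map_zero]
    exact pow_pos (zero_lt_one.trans one_lt) _
  · rw [Algebra.smul_def, map_mul, P.valuation_algebraMap hi0, one_mul, map_pow]
    refine pow_lt_pow_right₀ one_lt (lt_of_le_of_ne (Finset.mem_range_succ_iff.1 hi) ?_)
    rintro rfl
    exact hi0 g.eraseLead_coeff_natDegree

theorem valuation_aeval (P : Place F E) {x : E} (hx : x ∉ P.ring) {g : F[X]} (hg : g ≠ 0) :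
    P.ring.valuation (Polynomial.aeval x g) = P.ring.valuation x ^ g.natDegree := by
  rw [(P.isEquivalent_aeval hx hg).valuation_eq, map_mul,
    P.valuation_algebraMap (by simpa using hg), one_mul, map_pow]

end Place

/-! ### The place at infinity -/

section ArtinSchreierPoly

variable {F E : Type*} [Field F] [Field E] [Algebra F E] {p : ℕ} {f : F[X]} {x y : E}

open Polynomial (aevalAeval)

/-- The equation `Y ^ p - Y - f(X)` of the Artin–Schreier curve, as a polynomial in `Y` over
`F[X]`. -/
noncomputable def artinSchreierPoly (p : ℕ) {F : Type*} [Field F] (f : F[X]) : F[X][X] :=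
  Polynomial.X ^ p - Polynomial.X - Polynomial.C f

theorem monic_artinSchreierPoly (hp : 1 < p) (f : F[X]) : (artinSchreierPoly p f).Monic := by
  rw [artinSchreierPoly, sub_sub]
  apply Polynomial.monic_X_pow_sub
  rw [Polynomial.degree_X_add_C]
  exact_mod_cast hp

theorem natDegree_artinSchreierPoly (hp : 1 < p) (f : F[X]) :
    (artinSchreierPoly p f).natDegree = p := by
  rw [artinSchreierPoly, sub_sub, Polynomial.natDegree_sub_eq_left_of_natDegree_lt,
    Polynomial.natDegree_X_pow]
  rwa [Polynomial.natDegree_X_pow, Polynomial.natDegree_X_add_C]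

theorem natDegree_modByMonic_artinSchreierPoly_lt (hp : 1 < p) (f : F[X]) (G : F[X][X]) :
    (G %ₘ artinSchreierPoly p f).natDegree < p := by
  have natDegree_eq := natDegree_artinSchreierPoly hp f
  have natDegree_lt := Polynomial.natDegree_modByMonic_lt G (monic_artinSchreierPoly hp f)
    (fun h => by rw [h, Polynomial.natDegree_one] at natDegree_eq; omega)
  rwa [natDegree_eq] at natDegree_lt

theorem aevalAeval_eq_sum (G : F[X][X]) :
    aevalAeval x y G = ∑ j ∈ G.support, Polynomial.aeval x (G.coeff j) * y ^ j := by
  conv_lhs => rw [G.as_sum_support_C_mul_X_pow]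
  simp

theorem range_aevalAeval :
    (aevalAeval (R := F) x y).range = Algebra.adjoin F {x, y} := by
  apply le_antisymm
  · intro u hu
    obtain ⟨G, rfl⟩ := (AlgHom.mem_range _).1 hu
    rw [aevalAeval_eq_sum]
    refine sum_mem fun j _ => mul_mem ?_ (pow_mem (Algebra.subset_adjoin (by simp)) j)
    exact Algebra.adjoin_mono (by simp) (Polynomial.aeval_mem_adjoin_singleton F x)
  · refine Algebra.adjoin_le ?_
    rintro _ (rfl | rfl)
    · exact ⟨Polynomial.C Polynomial.X, by simp⟩
    · exact ⟨Polynomial.X, by simp⟩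

end ArtinSchreierPoly

theorem exponents_eq_zero_of_weight_eq_zero {p r : ℕ} (hpr : p.Coprime r) {a b : ℤ} (hp : p ≠ 0)
    (hb : |b| < p) (h : p * a + r * b = 0) : a = 0 ∧ b = 0 := by
  have dvd : (p : ℤ) ∣ r * b := ⟨-a, by linear_combination h⟩
  have hb0 : b = 0 :=
    Int.eq_zero_of_abs_lt_dvd ((Nat.isCoprime_iff_coprime.2 hpr).dvd_of_dvd_mul_left dvd) hb
  refine ⟨?_, hb0⟩
  simpa [hb0, hp] using h

namespace IsArtinSchreierFunctionField

variable {F E : Type*} [Field F] [Field E] [Algebra F E] {p : ℕ} {f : F[X]} {x y : E}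

open Polynomial (aevalAeval)

theorem exists_eq_aevalAeval_div (h : IsArtinSchreierFunctionField p f x y) (e : E) :
    ∃ G H : F[X][X], e = aevalAeval x y G / aevalAeval x y H := by
  have he : e ∈ IntermediateField.adjoin F {x, y} := by
    rw [h.generates]
    trivial
  rw [IntermediateField.mem_adjoin_iff_div, ← range_aevalAeval] at he
  obtain ⟨_, ⟨G, rfl⟩, _, ⟨H, rfl⟩, rfl⟩ := he
  exact ⟨G, H, rfl⟩

theorem aevalAeval_artinSchreierPoly (h : IsArtinSchreierFunctionField p f x y) :
    aevalAeval x y (artinSchreierPoly p f) = 0 := by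
  simp [artinSchreierPoly, h.equation]

theorem aevalAeval_modByMonic (h : IsArtinSchreierFunctionField p f x y) (G : F[X][X]) :
    aevalAeval x y (G %ₘ artinSchreierPoly p f) = aevalAeval x y G := by
  conv_rhs => rw [← Polynomial.modByMonic_add_div G (artinSchreierPoly p f)]
  rw [map_add, map_mul, h.aevalAeval_artinSchreierPoly, zero_mul, add_zero]

theorem valuation_y_pow (h : IsArtinSchreierFunctionField p f x y) (hp : 1 < p)
    (hpf : p.Coprime f.natDegree) {P : Place F E} (hx : x ∉ P.ring) :
    P.ring.valuation y ^ p = P.ring.valuation x ^ f.natDegree := by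
  have natDegree_ne_zero : f.natDegree ≠ 0 := by
    intro h0
    exact hp.ne' (by simpa [h0] using hpf)
  have valuation_eq : P.ring.valuation (y ^ p - y) = P.ring.valuation x ^ f.natDegree := by
    rw [h.equation, P.valuation_aeval hx (by rintro rfl; simp at natDegree_ne_zero)]
  have hy : y ∉ P.ring := fun hy => by
    have mem := (P.ring.valuation_le_one_iff _).2 (sub_mem (pow_mem hy p) hy)
    rw [valuation_eq] at mem
    exact mem.not_gt (one_lt_pow₀ (P.one_lt_valuation hx) natDegree_ne_zero)
  rw [← P.valuation_artinSchreier hp hy, valuation_eq]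

theorem valuation_monomial_pow (h : IsArtinSchreierFunctionField p f x y) (hp : 1 < p)
    (hpf : p.Coprime f.natDegree) {P : Place F E} (hx : x ∉ P.ring) (a b : ℤ) :
    P.ring.valuation (x ^ a * y ^ b) ^ p =
      P.ring.valuation x ^ (p * a + f.natDegree * b) := by
  have hx0 : P.ring.valuation x ≠ 0 := (zero_lt_one.trans (P.one_lt_valuation hx)).ne'
  rw [map_mul, map_zpow₀, map_zpow₀, mul_pow, ← zpow_natCast, ← zpow_natCast (_ ^ b),
    zpow_comm _ b, zpow_natCast (P.ring.valuation y), h.valuation_y_pow hp hpf hx, zpow_add₀ hx0,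
    mul_comm (p : ℤ), zpow_mul, zpow_mul, zpow_natCast _ f.natDegree]

theorem y_ne_zero (h : IsArtinSchreierFunctionField p f x y) (hp : 1 < p)
    (hpf : p.Coprime f.natDegree) {P : Place F E} (hx : x ∉ P.ring) : y ≠ 0 := by
  rintro rfl
  have valuation_eq := h.valuation_y_pow hp hpf hx
  rw [map_zero, zero_pow (Nat.ne_zero_of_lt hp)] at valuation_eq
  exact (pow_pos (zero_lt_one.trans (P.one_lt_valuation hx)) _).ne valuation_eq

/-- The exponents `p * deg (coeff j) + deg f * j` of the monomials of a polynomial of degree less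
than `p` in `y` are distinct, so the monomial with the largest one dominates. -/
theorem exists_isEquivalent_monomial (h : IsArtinSchreierFunctionField p f x y) (hp : 1 < p)
    (hpf : p.Coprime f.natDegree) {G : F[X][X]} (hG : G ≠ 0) (hdeg : G.natDegree < p) :
    ∃ (i j : ℕ) (c : F), c ≠ 0 ∧ j < p ∧ ∀ P : Place F E, x ∉ P.ring →
      P.IsEquivalent (aevalAeval x y G) (algebraMap F E c * (x ^ i * y ^ j)) := by
  obtain ⟨k, hk, hmax⟩ := Finset.exists_max_image G.support
    (fun j => p * (G.coeff j).natDegree + f.natDegree * j) (Polynomial.support_nonempty.2 hG)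
  have lt_p {j} (hj : j ∈ G.support) : j < p :=
    (Polynomial.le_natDegree_of_mem_supp _ hj).trans_lt hdeg
  have hk0 : G.coeff k ≠ 0 := Polynomial.mem_support_iff.1 hk
  have hc : (G.coeff k).leadingCoeff ≠ 0 := by simpa using hk0
  refine ⟨(G.coeff k).natDegree, k, (G.coeff k).leadingCoeff, hc, lt_p hk, fun P hx => ?_⟩
  have hy0 := h.y_ne_zero hp hpf hx
  have hx0 : x ≠ 0 := fun h0 => hx (h0 ▸ zero_mem _)
  rw [aevalAeval_eq_sum, ← Finset.add_sum_erase _ _ hk, ← mul_assoc]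
  refine ((P.isEquivalent_aeval hx hk0).mul_right (pow_ne_zero k hy0)).add_of_lt ?_
  rw [mul_assoc, map_mul, P.valuation_algebraMap hc, one_mul]
  refine Valuation.map_sum_lt _ (by simp [hx0, hy0]) fun j hj => ?_
  obtain ⟨hjk, hj⟩ := Finset.mem_erase.1 hj
  rw [map_mul, P.valuation_aeval hx (Polynomial.mem_support_iff.1 hj), ← map_pow, ← map_mul]
  refine lt_of_pow_lt_pow_left₀ p zero_le ?_
  have monomial_pow (i j : ℕ) := h.valuation_monomial_pow hp hpf hx i j
  simp only [zpow_natCast] at monomial_pow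
  rw [monomial_pow, monomial_pow]
  refine zpow_lt_zpow_right₀ (P.one_lt_valuation hx)
    (lt_of_le_of_ne (mod_cast hmax j hj) fun heq => hjk ?_)
  have abs_lt : |(j - k : ℤ)| < p := by
    have := lt_p hj
    have := lt_p hk
    rw [abs_lt]
    omega
  have := (exponents_eq_zero_of_weight_eq_zero hpf (Nat.ne_zero_of_lt hp) abs_lt
    (a := (G.coeff j).natDegree - (G.coeff k).natDegree) (by linear_combination heq)).2
  omega

theorem artinSchreierPoly_dvd (h : IsArtinSchreierFunctionField p f x y) (hp : 1 < p)
    (hpf : p.Coprime f.natDegree) {G : F[X][X]} (hG : aevalAeval x y G = 0) :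
    artinSchreierPoly p f ∣ G := by
  rw [← Polynomial.modByMonic_eq_zero_iff_dvd (monic_artinSchreierPoly hp f)]
  by_contra hne
  obtain ⟨i, j, c, -, -, hequiv⟩ := h.exists_isEquivalent_monomial hp hpf hne
    (natDegree_modByMonic_artinSchreierPoly_lt hp f G)
  obtain ⟨P, hP⟩ := Place.exists_notMem h.transcendental
  have valuation_eq := (hequiv P hP).valuation_eq
  rw [h.aevalAeval_modByMonic, hG, map_zero] at valuation_eq
  exact (hequiv P hP).valuation_right_pos.ne valuation_eq

theorem exists_isEquivalent_zpow (h : IsArtinSchreierFunctionField p f x y) (hp : 1 < p)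
    (hpf : p.Coprime f.natDegree) {e : E} (he : e ≠ 0) :
    ∃ (a b : ℤ) (c : F), c ≠ 0 ∧ |b| < p ∧ ∀ P : Place F E, x ∉ P.ring →
      P.IsEquivalent e (algebraMap F E c * (x ^ a * y ^ b)) := by
  obtain ⟨G, H, rfl⟩ := h.exists_eq_aevalAeval_div e
  rw [← h.aevalAeval_modByMonic G, ← h.aevalAeval_modByMonic H] at he ⊢
  have lt_p := natDegree_modByMonic_artinSchreierPoly_lt hp f
  obtain ⟨i, j, c, hc, hj, hequiv⟩ := h.exists_isEquivalent_monomial hp hpf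
    (by rintro h0; simp [h0] at he) (lt_p G)
  obtain ⟨i', j', c', hc', hj', hequiv'⟩ := h.exists_isEquivalent_monomial hp hpf
    (by rintro h0; simp [h0] at he) (lt_p H)
  refine ⟨i - i', j - j', c / c', div_ne_zero hc hc', by rw [abs_lt]; omega, fun P hx => ?_⟩
  have hx0 : x ≠ 0 := fun h0 => hx (h0 ▸ zero_mem _)
  convert (hequiv P hx).div (hequiv' P hx) using 1
  rw [map_div₀, zpow_sub₀ hx0, zpow_sub₀ (h.y_ne_zero hp hpf hx)]
  simp only [zpow_natCast]
  ring

theorem exists_pole_order (h : IsArtinSchreierFunctionField p f x y) (hp : 1 < p)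
    (hpf : p.Coprime f.natDegree) {e : E} (he : e ≠ 0) :
    ∃ (k : ℤ) (c : F), ∀ P : Place F E, x ∉ P.ring →
      (e ∈ P.ring ↔ k ≤ 0) ∧ (e ∈ P.ring → e - algebraMap F E c ∈ P.ring.nonunits) := by
  obtain ⟨a, b, c, hc, hb, hequiv⟩ := h.exists_isEquivalent_zpow hp hpf he
  set k : ℤ := p * a + f.natDegree * b with hk
  refine ⟨k, if k = 0 then c else 0, fun P hx => ?_⟩
  have one_lt := P.one_lt_valuation hx
  have valuation_eq : P.ring.valuation e ^ p = P.ring.valuation x ^ k := by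
    rw [(hequiv P hx).valuation_eq, map_mul, P.valuation_algebraMap hc, one_mul,
      h.valuation_monomial_pow hp hpf hx]
  have mem_iff : e ∈ P.ring ↔ k ≤ 0 := by
    rw [← P.ring.valuation_le_one_iff, ← pow_le_one_iff_of_nonneg zero_le (Nat.ne_zero_of_lt hp),
      valuation_eq, ← zpow_zero (P.ring.valuation x), zpow_le_zpow_iff_right₀ one_lt]
  refine ⟨mem_iff, fun hmem => ?_⟩
  rw [ValuationSubring.mem_nonunits_iff]
  split_ifs with hk0
  · obtain ⟨rfl, rfl⟩ :=
      exponents_eq_zero_of_weight_eq_zero hpf (Nat.ne_zero_of_lt hp) hb (hk ▸ hk0)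
    simpa [Place.IsEquivalent, P.valuation_algebraMap hc] using hequiv P hx
  · rw [map_zero, sub_zero, ← pow_lt_one_iff_of_nonneg zero_le (Nat.ne_zero_of_lt hp), valuation_eq,
      ← zpow_zero (P.ring.valuation x), zpow_lt_zpow_iff_right₀ one_lt]
    exact lt_of_le_of_ne (mem_iff.1 hmem) hk0

theorem exists_unique_pole (h : IsArtinSchreierFunctionField p f x y) (hp : 1 < p)
    (hpf : p.Coprime f.natDegree) :
    ∃ P : Place F E, P.degree = 1 ∧ x ∉ P.ring ∧ ∀ Q : Place F E, x ∉ Q.ring → Q = P := by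
  obtain ⟨P, hP⟩ := Place.exists_notMem h.transcendental
  refine ⟨P, P.degree_eq_one_iff.2 fun e heP => ?_, hP,
    fun Q hQ => Place.ext_ring (SetLike.ext fun e => ?_)⟩
  all_goals rcases eq_or_ne e 0 with rfl | he
  · exact ⟨0, by simp⟩
  · obtain ⟨k, c, hkc⟩ := h.exists_pole_order hp hpf he
    exact ⟨c, (hkc P hP).2 heP⟩
  · simp
  · obtain ⟨k, c, hkc⟩ := h.exists_pole_order hp hpf he
    rw [(hkc P hP).1, (hkc Q hQ).1]

end IsArtinSchreierFunctionField

/-! ### Places above the affine points -/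

section LocalRing

variable {K : Type*} [Field K]

theorem mem_ofPrime_iff_exists_div {A : Subring K} {M : Ideal A} [M.IsPrime] {z : K} :
    z ∈ (LocalSubring.ofPrime A M).toSubring ↔ ∃ a s : A, s ∉ M ∧ z = a / s := by
  constructor
  · intro hz
    obtain ⟨a, s, hmk⟩ := IsLocalization.exists_mk'_eq M.primeCompl
      (⟨z, hz⟩ : (LocalSubring.ofPrime A M).toSubring)
    have mul_eq : z * s = a := by
      have := IsLocalization.mk'_spec (LocalSubring.ofPrime A M).toSubring a s
      rw [hmk] at this
      exact congrArg Subtype.val this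
    refine ⟨a, s, s.2, (eq_div_iff ?_).2 mul_eq⟩
    exact fun h0 => s.2 ((ZeroMemClass.coe_eq_zero.1 h0 : (s : A) = 0) ▸ M.zero_mem)
  · rintro ⟨a, s, hs, rfl⟩
    obtain ⟨w, hw⟩ := (IsLocalization.map_units (LocalSubring.ofPrime A M).toSubring
      (⟨s, hs⟩ : M.primeCompl)).exists_right_inv
    have mul_eq : (s : K) * w = 1 := congrArg Subtype.val hw
    rw [div_eq_mul_inv, ← eq_inv_of_mul_eq_one_right mul_eq]
    exact mul_mem (LocalSubring.le_ofPrime A M a.2) w.2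

theorem valuationRing_ofPrime {A : Subring K} [IsNoetherianRing A] {M : Ideal A} [M.IsPrime]
    {t : A} (ht : t ∈ M) (hgen : ∀ s ∈ M, ∃ u ∉ M, t ∣ u * s) :
    ValuationRing (LocalSubring.ofPrime A M).toSubring := by
  set L := (LocalSubring.ofPrime A M).toSubring
  have : IsNoetherianRing L := IsLocalization.isNoetherianRing M.primeCompl L inferInstance
  have maximalIdeal_eq : IsLocalRing.maximalIdeal L = Ideal.span {algebraMap A L t} := by
    rw [← IsLocalization.AtPrime.map_eq_maximalIdeal M L]
    apply le_antisymm
    · rw [Ideal.map_le_iff_le_comap]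
      intro s hs
      obtain ⟨u, hu, hdvd⟩ := hgen s hs
      have isUnit : IsUnit (algebraMap A L u) :=
        IsLocalization.map_units L (⟨u, hu⟩ : M.primeCompl)
      rw [Ideal.mem_comap, Ideal.mem_span_singleton, ← isUnit.dvd_mul_left, ← map_mul]
      exact map_dvd _ hdvd
    · rw [Ideal.span_singleton_le_iff_mem]
      exact Ideal.mem_map_of_mem _ ht
  have isPrincipal : (IsLocalRing.maximalIdeal L).IsPrincipal := ⟨⟨_, maximalIdeal_eq⟩⟩
  exact ((tfae_of_isNoetherianRing_of_isLocalRing_of_isDomain L).out 4 1).1 isPrincipal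

theorem mem_valuationSubring_iff_exists_div {A : Subring K} [IsNoetherianRing A]
    [IsFractionRing A K] {V : ValuationSubring K} (hAV : A ≤ V.toSubring) {t : A}
    (ht : (t : K) ∈ V.nonunits)
    (hgen : ∀ s : A, (s : K) ∈ V.nonunits → ∃ u : A, (u : K) ∉ V.nonunits ∧ t ∣ u * s) {z : K} :
    z ∈ V ↔ ∃ a s : A, (s : K) ∉ V.nonunits ∧ z = a / s := by
  let M : Ideal A := (IsLocalRing.maximalIdeal V).comap (Subring.inclusion hAV)
  have : M.IsPrime := Ideal.comap_isPrime _ _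
  have mem_M (s : A) : s ∈ M ↔ (s : K) ∈ V.nonunits :=
    (V.coe_mem_nonunits_iff (a := Subring.inclusion hAV s)).symm
  have : ValuationRing (LocalSubring.ofPrime A M).toSubring := by
    refine valuationRing_ofPrime ((mem_M t).2 ht) fun s hs => ?_
    simpa only [mem_M] using hgen s ((mem_M s).1 hs)
  have : IsFractionRing (LocalSubring.ofPrime A M).toSubring K :=
    IsFractionRing.isFractionRing_of_isDomain_of_isLocalization M.primeCompl _ K
  constructor
  · intro hz
    simp only [← mem_M]
    rcases ValuationRing.isInteger_or_isInteger (LocalSubring.ofPrime A M).toSubring z with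
      ⟨w, rfl⟩ | ⟨w, hw : (w : K) = z⁻¹⟩
    · exact mem_ofPrime_iff_exists_div.1 w.2
    rcases eq_or_ne z 0 with rfl | hz0
    · exact ⟨0, 1, M.one_notMem, by simp⟩
    obtain ⟨a, s, hs, inv_eq⟩ := mem_ofPrime_iff_exists_div.1 (hw ▸ w.2)
    have z_eq : z = s / a := by rw [← inv_div, ← inv_eq, inv_inv]
    refine ⟨s, a, fun ha => hs ((mem_M s).2 ?_), z_eq⟩
    have ha0 : (a : K) ≠ 0 := by
      rintro ha0
      simp [ha0, hz0] at z_eq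
    have s_eq : (s : K) = a * z := by rw [z_eq, mul_div_cancel₀ _ ha0]
    rw [V.mem_nonunits_iff, s_eq, map_mul]
    exact mul_lt_one_of_lt_of_le ((mem_M a).1 ha) ((V.valuation_le_one_iff z).2 hz)
  · rintro ⟨a, s, hs, rfl⟩
    rw [V.mem_nonunits_iff, not_lt] at hs
    rw [← V.valuation_le_one_iff, map_div₀]
    exact div_le_one_of_le₀ (((V.valuation_le_one_iff _).2 (hAV a.2)).trans hs) zero_le

end LocalRing

section AffinePlaces

open Polynomial (aevalAeval C X C_sub)

variable {F E : Type*} [Field F] [Field E] [Algebra F E]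

theorem exists_eq_C_C_add (a b : F) (G : F[X][X]) :
    ∃ (H : F[X][X]) (q : F[X]),
      G = C (C (aevalAeval a b G)) + (X - C (C b)) * H + C ((X - C a) * q) := by
  obtain ⟨H, hH⟩ := Polynomial.X_sub_C_dvd_sub_C_eval (p := G) (a := C b)
  obtain ⟨q, hq⟩ := Polynomial.X_sub_C_dvd_sub_C_eval (p := G.eval (C b)) (a := a)
  refine ⟨H, q, ?_⟩
  rw [← hH, ← hq, C_sub, Polynomial.coe_aevalAeval_eq_evalEval, Polynomial.evalEval]
  ring

namespace Place

/-- The center of the place `P` on the plane with coordinates `x`, `y` is the rational point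
`(a, b)`: `x` and `y` are regular at `P` and take the values `a` and `b` there. -/
structure IsCenteredAt (P : Place F E) (x y : E) (a b : F) : Prop where
  x_sub_mem : x - algebraMap F E a ∈ P.ring.nonunits
  y_sub_mem : y - algebraMap F E b ∈ P.ring.nonunits

theorem aevalAeval_mem (P : Place F E) {x y : E} (hx : x ∈ P.ring) (hy : y ∈ P.ring)
    (G : F[X][X]) : aevalAeval x y G ∈ P.ring := by
  rw [aevalAeval_eq_sum]
  refine sum_mem fun j _ => mul_mem ?_ (pow_mem hy j)
  rw [Polynomial.aeval_eq_sum_range]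
  refine sum_mem fun i _ => ?_
  rw [Algebra.smul_def]
  exact mul_mem (P.algebraMap_mem _) (pow_mem hx i)

namespace IsCenteredAt

variable {P : Place F E} {x y : E} {a b : F}

theorem aevalAeval_mem (h : P.IsCenteredAt x y a b) (G : F[X][X]) : aevalAeval x y G ∈ P.ring :=
  P.aevalAeval_mem (P.mem_of_sub_mem_nonunits h.x_sub_mem)
    (P.mem_of_sub_mem_nonunits h.y_sub_mem) G

theorem aevalAeval_sub_mem_nonunits (h : P.IsCenteredAt x y a b) (G : F[X][X]) :
    aevalAeval x y G - algebraMap F E (aevalAeval a b G) ∈ P.ring.nonunits := by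
  obtain ⟨H, q, hG⟩ := exists_eq_C_C_add a b G
  have sub_eq : aevalAeval x y G - algebraMap F E (aevalAeval a b G) =
      (y - algebraMap F E b) * aevalAeval x y H +
        (x - algebraMap F E a) * aevalAeval x y (C q) := by
    have aevalAeval_eq := congrArg (aevalAeval x y) hG
    simp only [map_add, map_mul, map_sub, Polynomial.aevalAeval_C, Polynomial.aevalAeval_Y,
      Polynomial.aeval_C, Polynomial.aeval_X] at aevalAeval_eq
    rw [aevalAeval_eq, Polynomial.aevalAeval_C]
    ring
  rw [sub_eq]
  exact add_mem (P.mul_mem_nonunits h.y_sub_mem (h.aevalAeval_mem H))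
    (P.mul_mem_nonunits h.x_sub_mem (h.aevalAeval_mem (C q)))

theorem aevalAeval_mem_nonunits_iff (h : P.IsCenteredAt x y a b) {G : F[X][X]} :
    aevalAeval x y G ∈ P.ring.nonunits ↔ aevalAeval a b G = 0 := by
  have sub_mem_nonunits := h.aevalAeval_sub_mem_nonunits G
  rw [← P.algebraMap_mem_nonunits_iff]
  refine ⟨fun hmem => ?_, fun hmem => ?_⟩
  · simpa using sub_mem hmem sub_mem_nonunits
  · simpa using add_mem sub_mem_nonunits hmem

theorem valuation_aevalAeval_eq_one (h : P.IsCenteredAt x y a b) {H : F[X][X]}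
    (hH : aevalAeval a b H ≠ 0) : P.ring.valuation (aevalAeval x y H) = 1 := by
  refine le_antisymm ((P.ring.valuation_le_one_iff _).2 (h.aevalAeval_mem H)) ?_
  exact not_lt.1 fun hlt => hH (h.aevalAeval_mem_nonunits_iff.1 hlt)

theorem div_sub_mem_nonunits (h : P.IsCenteredAt x y a b) (G : F[X][X]) {H : F[X][X]}
    (hH : aevalAeval a b H ≠ 0) :
    aevalAeval x y G / aevalAeval x y H -
      algebraMap F E (aevalAeval a b G / aevalAeval a b H) ∈ P.ring.nonunits := by
  have valuation_eq := h.valuation_aevalAeval_eq_one hH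
  have hH0 : aevalAeval x y H ≠ 0 := fun h0 => by simp [h0] at valuation_eq
  set c := aevalAeval a b G / aevalAeval a b H with hc
  have numerator_mem : aevalAeval x y (G - C (C c) * H) ∈ P.ring.nonunits := by
    rw [h.aevalAeval_mem_nonunits_iff, map_sub, map_mul, Polynomial.aevalAeval_C,
      Polynomial.aeval_C, Algebra.algebraMap_self_apply, hc, div_mul_cancel₀ _ hH, sub_self]
  rw [ValuationSubring.mem_nonunits_iff] at numerator_mem ⊢
  rw [div_sub' hH0, map_div₀, valuation_eq, div_one]
  simpa [mul_comm] using numerator_mem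

theorem unique_center {a' b' : F} (h : P.IsCenteredAt x y a b) (h' : P.IsCenteredAt x y a' b') :
    (a, b) = (a', b') := by
  have hx := sub_mem h.x_sub_mem h'.x_sub_mem
  have hy := sub_mem h.y_sub_mem h'.y_sub_mem
  rw [sub_sub_sub_cancel_left, ← map_sub, P.algebraMap_mem_nonunits_iff, sub_eq_zero] at hx hy
  rw [hx, hy]

end IsCenteredAt

end Place

namespace IsArtinSchreierFunctionField

variable {p : ℕ} {f : F[X]} {x y : E}

theorem exists_isCenteredAt_of_degree_eq_one (h : IsArtinSchreierFunctionField p f x y)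
    (hp : 1 < p) {P : Place F E} (hP : P.degree = 1) (hx : x ∈ P.ring) :
    ∃ c ∈ affinePoints p f, P.IsCenteredAt x y c.1 c.2 := by
  rw [P.degree_eq_one_iff] at hP
  have hy : y ∈ P.ring := by
    by_contra hy
    have mem := P.aevalAeval_mem hx (zero_mem _) (C f)
    rw [Polynomial.aevalAeval_C, ← h.equation, ← P.ring.valuation_le_one_iff,
      P.valuation_artinSchreier hp hy] at mem
    exact mem.not_gt (one_lt_pow₀ (P.one_lt_valuation hy) (Nat.ne_zero_of_lt hp))
  obtain ⟨a, ha⟩ := hP x hx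
  obtain ⟨b, hb⟩ := hP y hy
  have hcenter : P.IsCenteredAt x y a b := ⟨ha, hb⟩
  refine ⟨(a, b), ?_, hcenter⟩
  have mem_nonunits : aevalAeval x y (artinSchreierPoly p f) ∈ P.ring.nonunits := by
    rw [h.aevalAeval_artinSchreierPoly]
    exact zero_mem _
  rw [hcenter.aevalAeval_mem_nonunits_iff] at mem_nonunits
  simpa [artinSchreierPoly, affinePoints, sub_eq_zero] using mem_nonunits

theorem isFractionRing_range_aevalAeval (h : IsArtinSchreierFunctionField p f x y) :
    IsFractionRing (aevalAeval (R := F) x y).toRingHom.range E := by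
  refine .of_field _ _ fun z => ?_
  obtain ⟨G, H, rfl⟩ := h.exists_eq_aevalAeval_div z
  exact ⟨⟨_, G, rfl⟩, ⟨_, H, rfl⟩, rfl⟩

theorem y_sub_pow_sub_one_mul (h : IsArtinSchreierFunctionField p f x y) [CharP F p]
    [Fact p.Prime] {a b : F} (hab : (a, b) ∈ affinePoints p f) :
    ((y - algebraMap F E b) ^ (p - 1) - 1) * (y - algebraMap F E b) =
      Polynomial.aeval x f - algebraMap F E (f.eval a) := by
  have := charP_of_injective_algebraMap (algebraMap F E).injective p
  have hp0 : p ≠ 0 := (Fact.out : p.Prime).ne_zero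
  have hab : b ^ p - b = f.eval a := hab
  rw [sub_one_mul, pow_sub_one_mul hp0, sub_pow_char, ← h.equation, ← hab, map_sub, map_pow]
  ring

/-- `x - a` generates the ideal of the point `(a, b)` locally, since in
`((y - b) ^ (p - 1) - 1) * (y - b) = f(x) - f(a)` the first factor does not vanish at `(a, b)`. -/
theorem exists_x_sub_dvd (h : IsArtinSchreierFunctionField p f x y) [CharP F p]
    [Fact p.Prime] {a b : F} (hab : (a, b) ∈ affinePoints p f) {G : F[X][X]}
    (hG : aevalAeval a b G = 0) :
    ∃ U K : F[X][X], aevalAeval a b U ≠ 0 ∧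
      aevalAeval x y (U * G) = (x - algebraMap F E a) * aevalAeval x y K := by
  have hp := (Fact.out : p.Prime).one_lt
  obtain ⟨H, q, hHq⟩ := exists_eq_C_C_add a b G
  obtain ⟨g, hg⟩ := Polynomial.X_sub_C_dvd_sub_C_eval (p := f) (a := a)
  have aeval_sub := congrArg (Polynomial.aeval x) hg
  simp only [map_sub, map_mul, Polynomial.aeval_C, Polynomial.aeval_X] at aeval_sub
  have y_sub := h.y_sub_pow_sub_one_mul hab
  rw [aeval_sub] at y_sub
  refine ⟨(X - C (C b)) ^ (p - 1) - 1, C g * H + ((X - C (C b)) ^ (p - 1) - 1) * C q, ?_, ?_⟩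
  · simp [zero_pow (Nat.sub_ne_zero_of_lt hp)]
  · rw [hHq, hG]
    simp only [map_add, map_mul, map_sub, map_pow, map_one, map_zero, zero_add,
      Polynomial.aevalAeval_C, Polynomial.aevalAeval_Y, Polynomial.aeval_C, Polynomial.aeval_X]
    linear_combination aevalAeval x y H * y_sub

theorem mem_ring_iff_of_isCenteredAt (h : IsArtinSchreierFunctionField p f x y) [CharP F p]
    [Fact p.Prime] {a b : F} (hab : (a, b) ∈ affinePoints p f) {P : Place F E}
    (hP : P.IsCenteredAt x y a b) {z : E} :
    z ∈ P.ring ↔ ∃ G H : F[X][X], aevalAeval a b H ≠ 0 ∧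
      z = aevalAeval x y G / aevalAeval x y H := by
  let A : Subring E := (aevalAeval (R := F) x y).toRingHom.range
  have : IsFractionRing A E := h.isFractionRing_range_aevalAeval
  have hAP : A ≤ P.ring.toSubring := by
    rintro _ ⟨G, rfl⟩
    exact hP.aevalAeval_mem G
  have : IsNoetherianRing A := inferInstanceAs (IsNoetherianRing (RingHom.range _))
  have exists_dvd (s : A) (hs : (s : E) ∈ P.ring.nonunits) : ∃ u : A, (u : E) ∉ P.ring.nonunits ∧
      (⟨x - algebraMap F E a, C (X - C a), by simp⟩ : A) ∣ u * s := by
    obtain ⟨_, G, rfl⟩ := s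
    obtain ⟨U, K, hU, mul_eq⟩ := h.exists_x_sub_dvd hab (hP.aevalAeval_mem_nonunits_iff.1 hs)
    refine ⟨⟨_, U, rfl⟩, mt hP.aevalAeval_mem_nonunits_iff.1 hU, ⟨_, K, rfl⟩, Subtype.ext ?_⟩
    rw [map_mul] at mul_eq
    exact mul_eq
  rw [mem_valuationSubring_iff_exists_div hAP hP.x_sub_mem exists_dvd]
  constructor
  · rintro ⟨⟨_, G, rfl⟩, ⟨_, H, rfl⟩, hH, rfl⟩
    exact ⟨G, H, mt hP.aevalAeval_mem_nonunits_iff.2 hH, rfl⟩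
  · rintro ⟨G, H, hH, rfl⟩
    exact ⟨⟨_, G, rfl⟩, ⟨_, H, rfl⟩, mt hP.aevalAeval_mem_nonunits_iff.1 hH, rfl⟩

theorem eq_of_isCenteredAt (h : IsArtinSchreierFunctionField p f x y) [CharP F p]
    [Fact p.Prime] {a b : F} (hab : (a, b) ∈ affinePoints p f) {P Q : Place F E}
    (hP : P.IsCenteredAt x y a b) (hQ : Q.IsCenteredAt x y a b) : P = Q :=
  Place.ext_ring <| SetLike.ext fun _ => by
    rw [h.mem_ring_iff_of_isCenteredAt hab hP, h.mem_ring_iff_of_isCenteredAt hab hQ]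

theorem degree_eq_one_of_isCenteredAt (h : IsArtinSchreierFunctionField p f x y) [CharP F p]
    [Fact p.Prime] {a b : F} (hab : (a, b) ∈ affinePoints p f) {P : Place F E}
    (hP : P.IsCenteredAt x y a b) : P.degree = 1 := by
  rw [P.degree_eq_one_iff]
  intro z hz
  obtain ⟨G, H, hH, rfl⟩ := (h.mem_ring_iff_of_isCenteredAt hab hP).1 hz
  exact ⟨_, hP.div_sub_mem_nonunits G hH⟩

theorem aevalAeval_eq_zero_of_mem_affinePoints (h : IsArtinSchreierFunctionField p f x y)
    (hp : 1 < p) (hpf : p.Coprime f.natDegree) {a b : F} (hab : (a, b) ∈ affinePoints p f)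
    {G : F[X][X]} (hG : aevalAeval x y G = 0) : aevalAeval a b G = 0 := by
  obtain ⟨K, rfl⟩ := h.artinSchreierPoly_dvd hp hpf hG
  have hab : b ^ p - b = f.eval a := hab
  rw [map_mul, artinSchreierPoly]
  simp [hab]

theorem exists_isCenteredAt (h : IsArtinSchreierFunctionField p f x y) (hp : 1 < p)
    (hpf : p.Coprime f.natDegree) {a b : F} (hab : (a, b) ∈ affinePoints p f) :
    ∃ P : Place F E, P.IsCenteredAt x y a b := by
  let A : Subring E := (aevalAeval (R := F) x y).toRingHom.range
  let toA : F[X][X] →+* A := (aevalAeval (R := F) x y).toRingHom.rangeRestrict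
  let M : Ideal F[X][X] := RingHom.ker (aevalAeval a b).toRingHom
  have map_ne_top : M.map toA ≠ ⊤ := by
    have ker_le : RingHom.ker toA ≤ M := fun G hG =>
      h.aevalAeval_eq_zero_of_mem_affinePoints hp hpf hab (congrArg Subtype.val hG)
    intro htop
    have comap_eq := Ideal.comap_map_of_surjective' toA (RingHom.rangeRestrict_surjective _) M
    rw [htop, Ideal.comap_top, sup_eq_left.2 ker_le] at comap_eq
    exact RingHom.ker_ne_top _ comap_eq.symm
  obtain ⟨V, hAV, hIV⟩ := (M.map toA).image_subset_nonunits_valuationSubring map_ne_top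
  have mem_nonunits {G : F[X][X]} (hG : aevalAeval a b G = 0) :
      aevalAeval x y G ∈ V.nonunits :=
    hIV ⟨toA G, Ideal.mem_map_of_mem _ hG, rfl⟩
  have x_sub_mem : x - algebraMap F E a ∈ V.nonunits := by
    rw [show x - algebraMap F E a = aevalAeval x y (C (X - C a)) by simp]
    exact mem_nonunits (by simp)
  have y_sub_mem : y - algebraMap F E b ∈ V.nonunits := by
    rw [show y - algebraMap F E b = aevalAeval x y (X - C (C b)) by simp]
    exact mem_nonunits (by simp)
  have x_sub_ne_zero : x - algebraMap F E a ≠ 0 := by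
    rw [sub_ne_zero]
    rintro rfl
    exact h.transcendental (isAlgebraic_algebraMap a)
  refine ⟨⟨V, fun c => hAV ⟨C (C c), by simp⟩, ?_⟩, x_sub_mem, y_sub_mem⟩
  rintro rfl
  exact ((⊤ : ValuationSubring E).mem_nonunits_iff_or.1 x_sub_mem).elim x_sub_ne_zero
    fun hnot => hnot (ValuationSubring.mem_top _)

theorem exists_rationalPlaces_eq_insert (h : IsArtinSchreierFunctionField p f x y) [CharP F p]
    [Fact p.Prime] (hpf : p.Coprime f.natDegree) :
    ∃ (P : Place F E) (g : affinePoints p f → Place F E), x ∉ P.ring ∧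
      (∀ c, (g c).IsCenteredAt x y c.1.1 c.1.2) ∧
      rationalPlaces F E = insert P (Set.range g) := by
  have hp : 1 < p := (Fact.out : p.Prime).one_lt
  obtain ⟨P₀, hP₀, hxP₀, eq_P₀⟩ := h.exists_unique_pole hp hpf
  have (c : affinePoints p f) := h.exists_isCenteredAt hp hpf c.2
  choose g hg using this
  refine ⟨P₀, g, hxP₀, hg, Set.ext fun P => ⟨fun hP => ?_, ?_⟩⟩
  · by_cases hx : x ∈ P.ring
    · obtain ⟨c, hc, hcenter⟩ := h.exists_isCenteredAt_of_degree_eq_one hp hP hx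
      exact Or.inr ⟨⟨c, hc⟩, h.eq_of_isCenteredAt hc (hg ⟨c, hc⟩) hcenter⟩
    · exact Or.inl (eq_P₀ P hx)
  · rintro (rfl | ⟨c, rfl⟩)
    · exact hP₀
    · exact h.degree_eq_one_of_isCenteredAt c.2 (hg c)

theorem rationalPlaces_finite_and_ncard (h : IsArtinSchreierFunctionField p f x y) [Finite F]
    [CharP F p] [Fact p.Prime] (hpf : p.Coprime f.natDegree) :
    (rationalPlaces F E).Finite ∧
      (rationalPlaces F E).ncard = 1 + (affinePoints p f).ncard := by
  obtain ⟨P, g, hxP, hg, rationalPlaces_eq⟩ := h.exists_rationalPlaces_eq_insert hpf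
  have hinj : Function.Injective g := fun c d hcd =>
    Subtype.ext ((hg c).unique_center (hcd ▸ hg d))
  have hP : P ∉ Set.range g := by
    rintro ⟨c, rfl⟩
    exact hxP ((g c).mem_of_sub_mem_nonunits (hg c).x_sub_mem)
  have range_finite : (Set.range g).Finite := Set.finite_range g
  refine ⟨rationalPlaces_eq ▸ range_finite.insert P, ?_⟩
  rw [rationalPlaces_eq, Set.ncard_insert_of_notMem hP range_finite, ← Set.image_univ,
    Set.ncard_image_of_injective _ hinj, Set.ncard_univ, Nat.card_coe_set_eq, add_comm]

end IsArtinSchreierFunctionField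

end AffinePlaces

theorem exists_pow_sub_eq {K : Type*} [Field K] [IsAlgClosed K] {p : ℕ} (hp : 1 < p)
    (c : K) : ∃ y : K, y ^ p - y = c := by
  have degree_ne_zero : (Polynomial.X ^ p - (Polynomial.X + Polynomial.C c)).degree ≠ 0 := by
    rw [Polynomial.degree_sub_eq_left_of_degree_lt, Polynomial.degree_X_pow]
    · exact_mod_cast Nat.ne_zero_of_lt hp
    · rw [Polynomial.degree_X_add_C, Polynomial.degree_X_pow]
      exact_mod_cast hp
  obtain ⟨y, hy⟩ := IsAlgClosed.exists_root _ degree_ne_zero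
  refine ⟨y, ?_⟩
  simp only [Polynomial.IsRoot, Polynomial.eval_sub, Polynomial.eval_pow, Polynomial.eval_X,
    Polynomial.eval_add, Polynomial.eval_C] at hy
  linear_combination hy

theorem exists_isArtinSchreierFunctionField {F : Type u} [Field F] {p : ℕ} (hp : 1 < p)
    (f : F[X]) : ∃ (E : Type u) (_ : Field E) (_ : Algebra F E) (x y : E),
      IsArtinSchreierFunctionField p f x y := by
  let Ω := AlgebraicClosure (RatFunc F)
  let x : Ω := algebraMap (RatFunc F) Ω RatFunc.X
  have transcendental_x : Transcendental F x :=
    (transcendental_algebraMap_iff (algebraMap (RatFunc F) Ω).injective).2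
      RatFunc.transcendental_X
  obtain ⟨y, hy⟩ := exists_pow_sub_eq hp (Polynomial.aeval x f)
  let K := IntermediateField.adjoin F {x, y}
  let x' : K := ⟨x, IntermediateField.subset_adjoin F _ (by simp)⟩
  let y' : K := ⟨y, IntermediateField.subset_adjoin F _ (by simp)⟩
  refine ⟨K, inferInstance, inferInstance, x', y', ?_, Subtype.ext ?_, ?_⟩
  · exact (transcendental_algebraMap_iff (algebraMap K Ω).injective).1 transcendental_x
  · exact hy.trans (Polynomial.aeval_algebraMap_apply Ω x' f)
  · apply IntermediateField.map_injective K.val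
    rw [IntermediateField.adjoin_map, ← AlgHom.fieldRange_eq_map, IntermediateField.fieldRange_val,
      Set.image_pair]
    rfl

/-! ### Comparison with the Serre bound -/

theorem le_floor_two_mul_sqrt {n : ℤ} {q : ℕ} (h : n ^ 2 ≤ 4 * q) : n ≤ ⌊2 * √(q : ℝ)⌋ := by
  rw [Int.le_floor, ← div_le_iff₀' two_pos]
  apply Real.le_sqrt_of_sq_le
  have : (n : ℝ) ^ 2 ≤ 4 * q := mod_cast h
  linarith

theorem two_mul_three_pow_lt_mul_floor_sqrt {k : ℕ} (hk : k ≠ 0) :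
    2 * (3 : ℤ) ^ (k + 1) < 2 * ⌊2 * √((3 ^ (2 * k + 1) : ℕ) : ℝ)⌋ := by
  have three_le : (3 : ℤ) ≤ 3 ^ k := le_self_pow₀ (by norm_num) hk
  have sq_le : ((3 : ℤ) ^ (k + 1) + 1) ^ 2 ≤ 4 * (3 ^ (2 * k + 1) : ℕ) := by
    calc ((3 : ℤ) ^ (k + 1) + 1) ^ 2 = 9 * (3 ^ k) ^ 2 + (6 * 3 ^ k + 1) := by ring
      _ ≤ 9 * (3 ^ k) ^ 2 + 3 * (3 ^ k) ^ 2 := by nlinarith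
      _ = 4 * (3 ^ (2 * k + 1) : ℕ) := by push_cast; ring
  linarith [le_floor_two_mul_sqrt sq_le]

theorem two_mul_pow_lt_mul_floor_sqrt {p : ℕ} (hp : 4 ≤ p) (k : ℕ) :
    2 * (p : ℤ) ^ (k + 1) < (p - 1) * ⌊2 * √((p ^ (2 * k + 1) : ℕ) : ℝ)⌋ := by
  have four_le : (4 : ℤ) ≤ p := mod_cast hp
  have zero_lt_pow : (0 : ℤ) < p ^ k := by positivity
  have sq_le : (4 * (p : ℤ) ^ k) ^ 2 ≤ 4 * (p ^ (2 * k + 1) : ℕ) := by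
    calc (4 * (p : ℤ) ^ k) ^ 2 = 4 * (4 * p ^ (2 * k)) := by ring
      _ ≤ 4 * (p * p ^ (2 * k)) := by gcongr
      _ = 4 * (p ^ (2 * k + 1) : ℕ) := by push_cast; ring
  calc 2 * (p : ℤ) ^ (k + 1) = 2 * p * p ^ k := by ring
    _ < (p - 1) * (4 * p ^ k) := by nlinarith
    _ ≤ (p - 1) * ⌊2 * √((p ^ (2 * k + 1) : ℕ) : ℝ)⌋ :=
      mul_le_mul_of_nonneg_left (le_floor_two_mul_sqrt sq_le) (by linarith)

theorem lt_serreBound_two_iff {p m : ℕ} {n : ℤ} :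
    ((p ^ m + 1 + n : ℤ) : ℝ) < serreBound p (p ^ m) 2 ↔
      2 * n < (p - 1) * ⌊2 * √((p ^ m : ℕ) : ℝ)⌋ := by
  have cast_iff : 2 * n < (p - 1) * ⌊2 * √((p ^ m : ℕ) : ℝ)⌋ ↔
      2 * (n : ℝ) < (p - 1) * ⌊2 * √((p ^ m : ℕ) : ℝ)⌋ := by exact_mod_cast Iff.rfl
  rw [cast_iff, serreBound]
  push_cast
  constructor <;> intro h <;> linarith

theorem serreBound_three : serreBound 3 3 2 = 7 := by
  have floor_eq : ⌊2 * √(3 : ℝ)⌋ = 3 := by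
    have sq_sqrt := Real.sq_sqrt (by norm_num : (0 : ℝ) ≤ 3)
    have sqrt_nonneg := Real.sqrt_nonneg 3
    rw [Int.floor_eq_iff]
    constructor <;> push_cast <;> nlinarith
  simp only [serreBound, Nat.cast_ofNat, floor_eq]
  norm_num

theorem lt_serreBound_of_odd {p m : ℕ} (hp : 2 < p) (hm : Odd m) (hq : p ^ m ≠ 3) :
    (((p : ℤ) ^ m + 1 + (p : ℤ) ^ ((m + 1) / 2) : ℤ) : ℝ) < serreBound p (p ^ m) 2 := by
  obtain ⟨k, rfl⟩ := hm
  rw [show (2 * k + 1 + 1) / 2 = k + 1 by omega, lt_serreBound_two_iff]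
  rcases eq_or_lt_of_le (Nat.succ_le_of_lt hp) with rfl | hp
  · have hk : k ≠ 0 := by
      rintro rfl
      exact hq rfl
    exact_mod_cast two_mul_three_pow_lt_mul_floor_sqrt hk
  · exact two_mul_pow_lt_mul_floor_sqrt hp k

theorem le_serreBound_and_lt_serreBound_iff {p m : ℕ} (hp : 2 < p) (hm : Odd m) :
    ((((p : ℤ) ^ m + 1 + (p : ℤ) ^ ((m + 1) / 2) : ℤ) : ℝ) ≤ serreBound p (p ^ m) 2) ∧
      ((((p : ℤ) ^ m + 1 + (p : ℤ) ^ ((m + 1) / 2) : ℤ) : ℝ) < serreBound p (p ^ m) 2 ↔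
        p ^ m ≠ 3) := by
  by_cases hq : p ^ m = 3
  · have hm0 : m ≠ 0 := hm.pos.ne'
    have p_eq : p = 3 := le_antisymm (hq ▸ Nat.le_self_pow hm0 p) hp
    subst p_eq
    have m_eq : m = 1 := Nat.pow_right_injective (by norm_num : 2 ≤ 3) (hq.trans (pow_one 3).symm)
    subst m_eq
    norm_num [serreBound_three]
  · have hlt := lt_serreBound_of_odd hp hm hq
    exact ⟨hlt.le, fun _ => hq, fun _ => hlt⟩

/-! ### Artin–Schreier curves of degree two -/

theorem IsArtinSchreierFunctionField.rationalPlaces_finite_and_ncard_of_natDegree_eq_two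
    {p : ℕ} [Fact p.Prime] (hp : p ≠ 2) {F E : Type*} [Field F] [Fintype F] [Algebra (ZMod p) F]
    [Field E] [Algebra F E] {f : F[X]} (hf : f.natDegree = 2) {x y : E}
    (h : IsArtinSchreierFunctionField p f x y) :
    (rationalPlaces F E).Finite ∧
      ((rationalPlaces F E).ncard : ℤ) = 1 + p * traceZeroCount p (fun x => f.eval x) := by
  have : CharP F p := charP_of_injective_algebraMap' (ZMod p) p
  obtain ⟨hfin, hncard⟩ := h.rationalPlaces_finite_and_ncard
    (hf ▸ (Nat.coprime_primes Fact.out Nat.prime_two).2 hp)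
  exact ⟨hfin, by rw [hncard, ncard_affinePoints]; push_cast; rfl⟩

theorem theorem5p5 {p m : ℕ} [Fact p.Prime] (hp : p ≠ 2)
    {F : Type u} [Field F] [Fintype F] [DecidableEq F] [Algebra (ZMod p) F]
    (hq : Fintype.card F = p ^ m) (φ : F ≃ₗ[ZMod p] (Fin m → ZMod p)) :
    (∀ f : F[X], f.natDegree = 2 →
      ∀ (E : Type v) [Field E] [Algebra F E] (x y : E), IsArtinSchreierFunctionField p f x y →
        (rationalPlaces F E).Finite ∧ ((rationalPlaces F E).ncard : ℤ) ≤ codeBound φ 2) ∧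
    (Odd m → codeBound φ 2 = (p : ℤ) ^ m + 1 + (p : ℤ) ^ ((m + 1) / 2)) ∧
    (Even m → codeBound φ 2 = (p : ℤ) ^ m + 1 + ((p : ℤ) - 1) * (p : ℤ) ^ (m / 2)) ∧
    (∃ f : F[X], f.natDegree = 2 ∧
      ∃ (E : Type u) (_ : Field E) (_ : Algebra F E) (x y : E),
        IsArtinSchreierFunctionField p f x y ∧
        (rationalPlaces F E).Finite ∧ ((rationalPlaces F E).ncard : ℤ) = codeBound φ 2) ∧
    (Odd m → (codeBound φ 2 : ℝ) ≤ serreBound p (p ^ m) 2 ∧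
      ((codeBound φ 2 : ℝ) < serreBound p (p ^ m) 2 ↔ p ^ m ≠ 3)) := by
  have hbound := codeBound_two_eq hp hq φ
  have hodd (hm : Odd m) : codeBound φ 2 = (p : ℤ) ^ m + 1 + (p : ℤ) ^ ((m + 1) / 2) := by
    rw [hbound, quadraticExcess, if_neg (Nat.not_even_iff_odd.2 hm)]
  refine ⟨fun f hf E _ _ x y h => ?_, hodd, fun hm => ?_, ?_, fun hm => ?_⟩
  · obtain ⟨hfin, hncard⟩ := h.rationalPlaces_finite_and_ncard_of_natDegree_eq_two hp hf
    refine ⟨hfin, ?_⟩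
    linarith [mul_traceZeroCount_eval_le_of_natDegree_eq_two hp hq hf]
  · rw [hbound, quadraticExcess, if_pos hm]
  · obtain ⟨f, hf, hcount⟩ := exists_natDegree_eq_two_and_mul_traceZeroCount_eq (F := F) hp hq
    obtain ⟨E, _, _, x, y, h⟩ :=
      exists_isArtinSchreierFunctionField (Fact.out : p.Prime).one_lt f
    obtain ⟨hfin, hncard⟩ := h.rationalPlaces_finite_and_ncard_of_natDegree_eq_two hp hf
    exact ⟨f, hf, E, _, _, x, y, h, hfin, by linarith⟩
  · rw [hodd hm]
    exact le_serreBound_and_lt_serreBound_iff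
      (lt_of_le_of_ne (Fact.out : p.Prime).two_le hp.symm) hm
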